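/- Let $\mathbb T^2=(\mathbb R/\mathbb Z)^2$, $\Omega^-=(-1,0)\times\mathbb T^2$ with points $x=(x_1,x')$, $\Gamma=\{0\}\times\mathbb T^2$, $\Gamma_-=\{-1\}\times\mathbb T^2$, and let $\nu=(1,0,0)$ be the outward unit normal on $\Gamma$. With boundary values understood as traces, let $$H^1_{\tau\Gamma}=\{\eta\in H^1(\Omega^-;\mathbb R^3):\ \nu\times\eta=0\text{ on }\Gamma\},\qquad H^1_{0\Gamma_-}=\{\phi\in H^1(\Omega^-):\ \phi=0\text{ on }\Gamma_-\},$$ $$\operatorname{Curl}_{\tau\Gamma}=\{\nabla\times\eta:\ \eta\in H^1_{\tau\Gamma}\},\qquad G_{0\Gamma_-}=\{\nabla\phi:\ \phi\in H^1_{0\Gamma_-}\}.$$ (i) The following orthogonal decomposition with respect to the $L^2$ inner product holds: $$L^2(\Omega^-;\mathbb R^3)=\operatorname{Curl}_{\tau\Gamma}\oplus G_{0\Gamma_-}.$$ (ii) There is a constant $C>0$ such that for every $v\in L^2(\Omega^-;\mathbb R^3)$ there exists exactly one pair $(\eta,\phi)$ with $\eta\in H^1_{\tau\Gamma}$, $\phi\in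 H^1_{0\Gamma_-}$, $$v=\nabla\times\eta+\nabla\phi,\qquad \operatorname{div}\eta=0\ \text{ in }\Omega^-,\qquad \eta_1=0\ \text{ on }\Gamma_-,$$ and this pair satisfies $$\|\eta\|_{H^1(\Omega^-)}+\|\nabla\phi\|_{L^2(\Omega^-)}\le C\,\|v\|_{L^2(\Omega^-)}.$$ -/

import Mathlib

open MeasureTheory Filter Topology Set
open scoped ENNReal ContDiff

namespace VacuumSlab

noncomputable section

/-- The infinite periodic slab `ℝ × 𝕋²`, where `𝕋 = ℝ / ℤ`. -/
abbrev Space : Type := ℝ × UnitAddTorus (Fin 2)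

/-- The universal cover `ℝ × ℝ²` of `ℝ × 𝕋²`. -/
abbrev Cover : Type := ℝ × (Fin 2 → ℝ)

/-- The covering map `(x₁, x₂, x₃) ↦ (x₁, x₂ mod 1, x₃ mod 1)`. -/
def toSpace (x : Cover) : Space := (x.1, fun i => (x.2 i : UnitAddCircle))

/-- The open domain `Ω⁻ = (-1, 0) × 𝕋²`. -/
def Omega : Set Space := Ioo (-1 : ℝ) 0 ×ˢ univ

/-- Lebesgue measure on `𝕋²` (of total mass `1`, as the periods are `1`). -/
def torusMeasure : Measure (UnitAddTorus (Fin 2)) :=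
  Measure.pi fun _ => AddCircle.haarAddCircle

instance : IsProbabilityMeasure torusMeasure := by
  unfold torusMeasure; infer_instance

/-- Lebesgue measure on `Ω⁻`. -/
def slabMeasure : Measure Space := (volume.restrict (Ioo (-1 : ℝ) 0)).prod torusMeasure

instance : IsFiniteMeasure slabMeasure := by
  unfold slabMeasure; infer_instance

/-- The three coordinate directions. -/
def dir : Fin 3 → Cover := ![(1, 0), (0, ![1, 0]), (0, ![0, 1])]

/-- `C^∞` functions on `ℝ × 𝕋²`: those whose (periodic) lift to `ℝ × ℝ²` is `C^∞`. -/
def IsSmooth (f : Space → ℝ) : Prop := ContDiff ℝ ∞ (f ∘ toSpace)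

/-- The classical partial derivative `∂ᵢ f`. -/
def pderiv (i : Fin 3) (f : Space → ℝ) (x : Space) : ℝ :=
  deriv (fun s : ℝ => f (x + toSpace (s • dir i))) 0

/-- Test functions: `C_c^∞(Ω⁻)`. -/
def IsTest (f : Space → ℝ) : Prop := IsSmooth f ∧ HasCompactSupport f ∧ tsupport f ⊆ Omega

/-- `L²(Ω⁻)`. -/
abbrev L2 : Type := Lp ℝ 2 slabMeasure

/-- `L²(Ω⁻; ℝ³)`, with `ℝ³` Euclidean. -/
abbrev L2Field : Type := Lp (EuclideanSpace ℝ (Fin 3)) 2 slabMeasure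

/-- The `i`-th component of a vector field in `L²(Ω⁻; ℝ³)`. -/
def comp (i : Fin 3) : L2Field →L[ℝ] L2 :=
  (EuclideanSpace.proj i : EuclideanSpace ℝ (Fin 3) →L[ℝ] ℝ).compLpL 2 slabMeasure

/-- The scalar function `u`, placed in the `i`-th component: `u eᵢ`. -/
def inComp (i : Fin 3) : L2 →L[ℝ] L2Field :=
  (ContinuousLinearMap.toSpanSingleton ℝ
    (EuclideanSpace.single i (1 : ℝ))).compLpL 2 slabMeasure

/-- `g` is the weak gradient of `u` in `Ω⁻`. -/
def IsWeakGrad (u : L2) (g : L2Field) : Prop :=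
  ∀ ψ : Space → ℝ, IsTest ψ → ∀ i : Fin 3,
    ∫ x, u x * pderiv i ψ x ∂slabMeasure = -∫ x, comp i g x * ψ x ∂slabMeasure

/-! ### Basic facts on smooth functions -/

theorem isOpenQuotientMap_toSpace : IsOpenQuotientMap toSpace :=
  IsOpenQuotientMap.prodMap (f := (id : ℝ → ℝ)) (g := Pi.map fun (_ : Fin 2) (t : ℝ) =>
    (t : UnitAddCircle)) IsOpenQuotientMap.id
    (IsOpenQuotientMap.piMap fun _ => QuotientAddGroup.isOpenQuotientMap_mk)

theorem toSpace_add (x y : Cover) : toSpace (x + y) = toSpace x + toSpace y := by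
  ext <;> simp [toSpace]

theorem IsSmooth.continuous {f : Space → ℝ} (hf : IsSmooth f) : Continuous f :=
  isOpenQuotientMap_toSpace.continuous_comp_iff.1 (ContDiff.continuous hf)

theorem IsSmooth.hasDerivAt {f : Space → ℝ} (hf : IsSmooth f) (i : Fin 3) (x : Cover) :
    HasDerivAt (fun s : ℝ => f (toSpace x + toSpace (s • dir i)))
      (fderiv ℝ (f ∘ toSpace) x (dir i)) 0 := by
  have h1 : HasFDerivAt (f ∘ toSpace) (fderiv ℝ (f ∘ toSpace) x) (x + (0 : ℝ) • dir i) := by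
    simpa using (ContDiff.differentiable hf (by simp) x).hasFDerivAt
  have h2 : HasDerivAt (fun s : ℝ => x + s • dir i) (dir i) 0 := by
    simpa using ((hasDerivAt_id (0 : ℝ)).smul_const (dir i)).const_add x
  have h3 := h1.comp_hasDerivAt (0 : ℝ) h2
  refine h3.congr_of_eventuallyEq (Eventually.of_forall fun s => ?_)
  simp [toSpace_add]

theorem IsSmooth.pderiv_toSpace {f : Space → ℝ} (hf : IsSmooth f) (i : Fin 3) (x : Cover) :
    pderiv i f (toSpace x) = fderiv ℝ (f ∘ toSpace) x (dir i) :=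
  (hf.hasDerivAt i x).deriv

theorem IsSmooth.pderiv {f : Space → ℝ} (hf : IsSmooth f) (i : Fin 3) :
    IsSmooth (VacuumSlab.pderiv i f) := by
  have h : VacuumSlab.pderiv i f ∘ toSpace = fun x => fderiv ℝ (f ∘ toSpace) x (dir i) :=
    funext fun x => hf.pderiv_toSpace i x
  unfold IsSmooth at hf ⊢
  rw [h]
  exact (hf.fderiv_right (m := ∞) (by simp)).clm_apply contDiff_const

theorem IsSmooth.add {f g : Space → ℝ} (hf : IsSmooth f) (hg : IsSmooth g) :
    IsSmooth (f + g) :=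
  ContDiff.add hf hg

theorem IsSmooth.smul {f : Space → ℝ} (c : ℝ) (hf : IsSmooth f) : IsSmooth (c • f) :=
  contDiff_const.smul hf

theorem IsSmooth.zero : IsSmooth (0 : Space → ℝ) := contDiff_const

theorem IsSmooth.pderiv_add {f g : Space → ℝ} (hf : IsSmooth f) (hg : IsSmooth g) (i : Fin 3) :
    VacuumSlab.pderiv i (f + g) = VacuumSlab.pderiv i f + VacuumSlab.pderiv i g := by
  funext z
  obtain ⟨x, rfl⟩ := isOpenQuotientMap_toSpace.surjective z
  have := ((hf.hasDerivAt i x).add (hg.hasDerivAt i x)).deriv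
  rw [Pi.add_apply, hf.pderiv_toSpace, hg.pderiv_toSpace]
  exact this

theorem IsSmooth.pderiv_smul {f : Space → ℝ} (c : ℝ) (hf : IsSmooth f) (i : Fin 3) :
    VacuumSlab.pderiv i (c • f) = c • VacuumSlab.pderiv i f := by
  funext z
  obtain ⟨x, rfl⟩ := isOpenQuotientMap_toSpace.surjective z
  have := ((hf.hasDerivAt i x).const_mul c).deriv
  rw [Pi.smul_apply, hf.pderiv_toSpace]
  exact this

theorem pderiv_zero (i : Fin 3) : pderiv i (0 : Space → ℝ) = 0 := by
  funext z
  simp [pderiv]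

theorem IsSmooth.aestronglyMeasurable {f : Space → ℝ} (hf : IsSmooth f) (μ : Measure Space) :
    AEStronglyMeasurable f μ :=
  hf.continuous.aestronglyMeasurable

theorem IsTest.memLp {ψ : Space → ℝ} (h : IsTest ψ) : MemLp ψ 2 slabMeasure :=
  h.1.continuous.memLp_of_hasCompactSupport h.2.1

theorem IsTest.memLp_pderiv {ψ : Space → ℝ} (h : IsTest ψ) (i : Fin 3) :
    MemLp (pderiv i ψ) 2 slabMeasure := by
  refine (h.1.pderiv i).continuous.memLp_of_hasCompactSupport (h.2.1.mono' ?_)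
  intro x hx
  by_contra hx'
  apply hx
  have h0 : ψ =ᶠ[𝓝 x] 0 := notMem_tsupport_iff_eventuallyEq.1 hx'
  have hc : Tendsto (fun s : ℝ => x + toSpace (s • dir i)) (𝓝 0) (𝓝 x) := by
    have hcont : Continuous (fun s : ℝ => x + toSpace (s • dir i)) :=
      continuous_const.add (isOpenQuotientMap_toSpace.continuous.comp
        (continuous_id.smul continuous_const))
    have := hcont.tendsto 0
    simpa [toSpace, ← Prod.zero_eq_mk, ← Pi.zero_def] using this
  have h1 : (fun s : ℝ => ψ (x + toSpace (s • dir i))) =ᶠ[𝓝 0] fun _ => 0 := hc.eventually h0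
  simpa [pderiv] using h1.deriv_eq

/-! ### The space `H¹(Ω⁻)` -/

theorem IsWeakGrad.add {u v : L2} {g h : L2Field} (hu : IsWeakGrad u g) (hv : IsWeakGrad v h) :
    IsWeakGrad (u + v) (g + h) := by
  intro ψ hψ i
  have e1 : ∫ x, (u + v) x * pderiv i ψ x ∂slabMeasure
      = ∫ x, u x * pderiv i ψ x ∂slabMeasure + ∫ x, v x * pderiv i ψ x ∂slabMeasure := by
    refine Eq.trans ?_ (integral_add ((Lp.memLp u).integrable_mul (hψ.memLp_pderiv i))
      ((Lp.memLp v).integrable_mul (hψ.memLp_pderiv i)))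
    refine integral_congr_ae ?_
    filter_upwards [Lp.coeFn_add u v] with x hx
    simp only [hx, Pi.add_apply, add_mul]
  have e2 : ∫ x, comp i (g + h) x * ψ x ∂slabMeasure
      = ∫ x, comp i g x * ψ x ∂slabMeasure + ∫ x, comp i h x * ψ x ∂slabMeasure := by
    rw [map_add]
    refine Eq.trans ?_ (integral_add ((Lp.memLp (comp i g)).integrable_mul hψ.memLp)
      ((Lp.memLp (comp i h)).integrable_mul hψ.memLp))
    refine integral_congr_ae ?_
    filter_upwards [Lp.coeFn_add (comp i g) (comp i h)] with x hx
    simp only [hx, Pi.add_apply, add_mul]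
  rw [e1, e2, hu ψ hψ i, hv ψ hψ i]
  ring

theorem IsWeakGrad.smul {u : L2} {g : L2Field} (c : ℝ) (hu : IsWeakGrad u g) :
    IsWeakGrad (c • u) (c • g) := by
  intro ψ hψ i
  have e1 : ∫ x, (c • u) x * pderiv i ψ x ∂slabMeasure
      = c * ∫ x, u x * pderiv i ψ x ∂slabMeasure := by
    rw [← integral_const_mul]
    refine integral_congr_ae ?_
    filter_upwards [Lp.coeFn_smul c u] with x hx
    rw [hx, Pi.smul_apply, smul_eq_mul, mul_assoc]
  have e2 : ∫ x, comp i (c • g) x * ψ x ∂slabMeasure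
      = c * ∫ x, comp i g x * ψ x ∂slabMeasure := by
    rw [← integral_const_mul, map_smul]
    refine integral_congr_ae ?_
    filter_upwards [Lp.coeFn_smul c (comp i g)] with x hx
    rw [hx, Pi.smul_apply, smul_eq_mul, mul_assoc]
  rw [e1, e2, hu ψ hψ i]
  ring

theorem IsWeakGrad.zero : IsWeakGrad 0 0 := by
  intro ψ _ i
  have e1 : ∫ x, (0 : L2) x * pderiv i ψ x ∂slabMeasure = 0 := by
    rw [← integral_zero Space ℝ (μ := slabMeasure)]
    refine integral_congr_ae ?_
    filter_upwards [Lp.coeFn_zero ℝ 2 slabMeasure] with x hx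
    rw [hx, Pi.zero_apply, zero_mul]
  have e2 : ∫ x, comp i (0 : L2Field) x * ψ x ∂slabMeasure = 0 := by
    rw [← integral_zero Space ℝ (μ := slabMeasure), map_zero]
    refine integral_congr_ae ?_
    filter_upwards [Lp.coeFn_zero ℝ 2 slabMeasure] with x hx
    rw [hx, Pi.zero_apply, zero_mul]
  rw [e1, e2, neg_zero]

/-- `H¹(Ω⁻)`: the functions `u ∈ L²(Ω⁻)` with a weak gradient in `L²(Ω⁻; ℝ³)`. An element is `u`
together with its (unique) weak gradient `∇u`, so that the norm is
`(‖u‖² + ‖∇u‖²)^(1/2)`, with `L²` norms. -/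
def H1 : Submodule ℝ (WithLp 2 (L2 × L2Field)) where
  carrier := {p | IsWeakGrad p.fst p.snd}
  add_mem' hp hq := hp.add hq
  zero_mem' := IsWeakGrad.zero
  smul_mem' c _ hp := hp.smul c

/-- The `L²` function underlying an element of `H¹(Ω⁻)`. -/
def fn : H1 →ₗ[ℝ] L2 where
  toFun u := u.1.fst
  map_add' _ _ := rfl
  map_smul' _ _ := rfl

/-- The gradient `∇ : H¹(Ω⁻) → L²(Ω⁻; ℝ³)`. -/
def grad : H1 →ₗ[ℝ] L2Field where
  toFun u := u.1.snd
  map_add' _ _ := rfl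
  map_smul' _ _ := rfl

/-- The weak partial derivative `∂ᵢ : H¹(Ω⁻) → L²(Ω⁻)`. -/
def partialD (i : Fin 3) : H1 →ₗ[ℝ] L2 := (comp i).toLinearMap ∘ₗ grad

/-- `H¹(Ω⁻; ℝ³)`, normed by `(∑ᵢ ‖ηᵢ‖²)^(1/2)`, with `H¹` norms. -/
abbrev H1Field : Type := PiLp 2 fun _ : Fin 3 => H1

/-- The component `ηᵢ` of a vector field. -/
def coord (i : Fin 3) : H1Field →ₗ[ℝ] H1 where
  toFun η := η i
  map_add' _ _ := rfl
  map_smul' _ _ := rfl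

/-- `∇ × η = (∂₂η₃ - ∂₃η₂, ∂₃η₁ - ∂₁η₃, ∂₁η₂ - ∂₂η₁)`; indices here run from `0` to `2`. -/
def curl : H1Field →ₗ[ℝ] L2Field :=
  (inComp 0).toLinearMap ∘ₗ (partialD 1 ∘ₗ coord 2 - partialD 2 ∘ₗ coord 1) +
  (inComp 1).toLinearMap ∘ₗ (partialD 2 ∘ₗ coord 0 - partialD 0 ∘ₗ coord 2) +
  (inComp 2).toLinearMap ∘ₗ (partialD 0 ∘ₗ coord 1 - partialD 1 ∘ₗ coord 0)

/-- `div η = ∂₁η₁ + ∂₂η₂ + ∂₃η₃`. -/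
def div : H1Field →ₗ[ℝ] L2 := ∑ i : Fin 3, partialD i ∘ₗ coord i

/-! ### Traces -/

/-- `g ∈ L²(𝕋²)` is the trace on `{x₁ = a} × 𝕋²` (used for `a = 0`, that is `Γ`, and `a = -1`, that
is `Γ₋`) of `u ∈ H¹(Ω⁻)`. The trace operator is the continuous extension to `H¹(Ω⁻)` of the
restriction to the boundary of functions that are smooth up to the boundary: some sequence of such
functions `f n` converges to `u` in `H¹(Ω⁻)`, and `f n (a, ·)` converges to `g` in `L²(𝕋²)`. -/
def HasTrace (a : ℝ) (u : H1) (g : UnitAddTorus (Fin 2) → ℝ) : Prop :=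
  ∃ f : ℕ → Space → ℝ, (∀ n, IsSmooth (f n)) ∧
    Tendsto (fun n => eLpNorm (⇑(fn u) - f n) 2 slabMeasure) atTop (𝓝 0) ∧
    (∀ i : Fin 3,
      Tendsto (fun n => eLpNorm (⇑(partialD i u) - pderiv i (f n)) 2 slabMeasure) atTop (𝓝 0)) ∧
    Tendsto (fun n => eLpNorm ((fun y => f n (a, y)) - g) 2 torusMeasure) atTop (𝓝 0)

theorem tendsto_eLpNorm_add {α : Type} [MeasurableSpace α] {μ : Measure α} {F G : ℕ → α → ℝ}
    (hF : ∀ n, AEStronglyMeasurable (F n) μ) (hG : ∀ n, AEStronglyMeasurable (G n) μ)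
    (h1 : Tendsto (fun n => eLpNorm (F n) 2 μ) atTop (𝓝 0))
    (h2 : Tendsto (fun n => eLpNorm (G n) 2 μ) atTop (𝓝 0)) {H : ℕ → α → ℝ}
    (hH : ∀ n, H n =ᵐ[μ] F n + G n) : Tendsto (fun n => eLpNorm (H n) 2 μ) atTop (𝓝 0) := by
  refine tendsto_of_tendsto_of_tendsto_of_le_of_le tendsto_const_nhds
    (by simpa using h1.add h2) (fun _ => zero_le) fun n => ?_
  rw [eLpNorm_congr_ae (hH n)]
  exact eLpNorm_add_le (hF n) (hG n) (by norm_num)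

theorem tendsto_eLpNorm_smul {α : Type} [MeasurableSpace α] {μ : Measure α} {F : ℕ → α → ℝ}
    (c : ℝ) (h1 : Tendsto (fun n => eLpNorm (F n) 2 μ) atTop (𝓝 0)) {H : ℕ → α → ℝ}
    (hH : ∀ n, H n =ᵐ[μ] c • F n) : Tendsto (fun n => eLpNorm (H n) 2 μ) atTop (𝓝 0) := by
  have h2 : ∀ n, eLpNorm (H n) 2 μ = ‖c‖ₑ * eLpNorm (F n) 2 μ := fun n => by
    rw [eLpNorm_congr_ae (hH n), eLpNorm_const_smul]
  simp only [h2]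
  simpa using ENNReal.Tendsto.const_mul h1 (Or.inr (by simp : ‖c‖ₑ ≠ ⊤))

/-- The `H¹` functions with vanishing trace on `{x₁ = a} × 𝕋²`. -/
def vanishingOn (a : ℝ) : Submodule ℝ H1 where
  carrier := {u | HasTrace a u 0}
  zero_mem' := by
    refine ⟨fun _ => 0, fun _ => IsSmooth.zero, ?_, fun i => ?_, ?_⟩
    · rw [map_zero]
      have h : ⇑(0 : L2) - (0 : Space → ℝ) =ᵐ[slabMeasure] 0 := by
        simpa using Lp.coeFn_zero ℝ 2 slabMeasure
      change Tendsto (fun _ : ℕ => eLpNorm (⇑(0 : L2) - (0 : Space → ℝ)) 2 slabMeasure) _ _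
      simp only [eLpNorm_congr_ae h, eLpNorm_zero, tendsto_const_nhds]
    · rw [map_zero]
      have h : ⇑(0 : L2) - pderiv i (0 : Space → ℝ) =ᵐ[slabMeasure] 0 := by
        simpa [pderiv_zero] using Lp.coeFn_zero ℝ 2 slabMeasure
      change Tendsto (fun _ : ℕ =>
        eLpNorm (⇑(0 : L2) - pderiv i (0 : Space → ℝ)) 2 slabMeasure) _ _
      simp only [eLpNorm_congr_ae h, eLpNorm_zero, tendsto_const_nhds]
    · simp
  add_mem' := by
    rintro u v ⟨f, hf, hf1, hf2, hf3⟩ ⟨g, hg, hg1, hg2, hg3⟩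
    refine ⟨fun n => f n + g n, fun n => (hf n).add (hg n), ?_, fun i => ?_, ?_⟩
    · refine tendsto_eLpNorm_add
        (fun n => (Lp.aestronglyMeasurable _).sub ((hf n).aestronglyMeasurable _))
        (fun n => (Lp.aestronglyMeasurable _).sub ((hg n).aestronglyMeasurable _)) hf1 hg1
        fun n => ?_
      rw [map_add]
      filter_upwards [Lp.coeFn_add (fn u) (fn v)] with x hx
      simp only [Pi.sub_apply, Pi.add_apply, hx]
      ring
    · refine tendsto_eLpNorm_add
        (fun n => (Lp.aestronglyMeasurable _).sub (((hf n).pderiv i).aestronglyMeasurable _))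
        (fun n => (Lp.aestronglyMeasurable _).sub (((hg n).pderiv i).aestronglyMeasurable _))
        (hf2 i) (hg2 i) fun n => ?_
      rw [map_add, (hf n).pderiv_add (hg n)]
      filter_upwards [Lp.coeFn_add (partialD i u) (partialD i v)] with x hx
      simp only [Pi.sub_apply, Pi.add_apply, hx]
      ring
    · have hm : ∀ {h : Space → ℝ}, IsSmooth h → AEStronglyMeasurable
          ((fun y : UnitAddTorus (Fin 2) => h (a, y)) - 0) torusMeasure := fun hh => by
        rw [sub_zero]
        exact (hh.continuous.comp (by fun_prop : Continuous
          fun y : UnitAddTorus (Fin 2) => ((a, y) : Space))).aestronglyMeasurable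
      refine tendsto_eLpNorm_add (fun n => hm (hf n)) (fun n => hm (hg n)) hf3 hg3
        fun n => Eventually.of_forall fun y => ?_
      simp
  smul_mem' := by
    rintro c u ⟨f, hf, hf1, hf2, hf3⟩
    refine ⟨fun n => c • f n, fun n => (hf n).smul c, ?_, fun i => ?_, ?_⟩
    · refine tendsto_eLpNorm_smul c hf1 fun n => ?_
      rw [map_smul]
      filter_upwards [Lp.coeFn_smul c (fn u)] with x hx
      simp only [Pi.sub_apply, Pi.smul_apply, hx, smul_eq_mul]
      ring
    · refine tendsto_eLpNorm_smul c (hf2 i) fun n => ?_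
      rw [map_smul, (hf n).pderiv_smul]
      filter_upwards [Lp.coeFn_smul c (partialD i u)] with x hx
      simp only [Pi.sub_apply, Pi.smul_apply, hx, smul_eq_mul]
      ring
    · exact tendsto_eLpNorm_smul c hf3 fun n => Eventually.of_forall fun y => by simp

/-! ### The spaces of the decomposition -/

/-- `a × η`, for a constant vector `a ∈ ℝ³`. -/
def constCross (a : Fin 3 → ℝ) : Fin 3 → (H1Field →ₗ[ℝ] H1) :=
  ![a 1 • coord 2 - a 2 • coord 1, a 2 • coord 0 - a 0 • coord 2, a 0 • coord 1 - a 1 • coord 0]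

/-- The unit normal `ν = (1, 0, 0)` on `Γ`, outward from `Ω⁻`. -/
def normal : Fin 3 → ℝ := ![1, 0, 0]

/-- `H¹_{τΓ}(Ω⁻; ℝ³)`: the `H¹` vector fields `η` with `ν × η = 0` on `Γ = {0} × 𝕋²`. -/
def H1TangentialOnGamma : Submodule ℝ H1Field :=
  ⨅ i : Fin 3, (vanishingOn 0).comap (constCross normal i)

/-- `H¹_{0Γ₋}(Ω⁻)`: the `H¹` functions that vanish on `Γ₋ = {-1} × 𝕋²`. -/
def H1VanishingOnGammaMinus : Submodule ℝ H1 := vanishingOn (-1)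

/-- `Curl_{τΓ}(Ω⁻)`: the curls of the fields in `H¹_{τΓ}(Ω⁻; ℝ³)`. -/
def CurlTau : Submodule ℝ L2Field := H1TangentialOnGamma.map curl

/-- `G_{0Γ₋}(Ω⁻)`: the gradients of the functions in `H¹_{0Γ₋}(Ω⁻)`. -/
def GradZero : Submodule ℝ L2Field := H1VanishingOnGammaMinus.map grad

/-- `η` and `φ` are potentials of `v`, with `η` normalized by `div η = 0` in `Ω⁻` and `η₁ = 0` on
`Γ₋`: `v = ∇ × η + ∇φ`, `η ∈ H¹_{τΓ}`, `φ ∈ H¹_{0Γ₋}`. -/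
structure IsPotential (v : L2Field) (η : H1Field) (φ : H1) : Prop where
  tangential : η ∈ H1TangentialOnGamma
  vanishing : φ ∈ H1VanishingOnGammaMinus
  div_eq_zero : div η = 0
  normal_eq_zero : coord 0 η ∈ vanishingOn (-1)
  eq : v = curl η + grad φ

end

end VacuumSlab

open VacuumSlab

/-!
The half-integer waves `sin((n + 1/2)π(x₁ + 1))`, which vanish on `Γ₋` and have zero normal
derivative on `Γ`, and `cos((n + 1/2)π(x₁ + 1))`, for which the two boundary components are
exchanged, multiplied by trigonometric monomials in `x'`, diagonalize the whole problem: `φ` and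
`η₁` belong to the sines, `η₂` and `η₃` to the cosines, and every derivative that occurs in `∇ ×
η`, `div η` and `∇φ` maps one family into the right one. More intrinsically, the two families are
distinguished by their parity under the reflections in the two boundary components (`parity`), so
that most of the argument uses parities of smooth functions only, and the waves (`mode`) enter
once, for the fact `eq_zero_of_inner_lap` that the Laplacians of the smooth functions of a given
parity are dense in `L²`. The waves are eigenfunctions of the Laplacian with nonzero eigenvalues,
and they are complete by the Stone–Weierstrass theorem.

Existence. For smooth fields with the right parities, Gaffney's identity `‖∇η‖² = ‖∇ × η‖² + ‖div
η‖²` (`sum_norm_sq_grad`), Poincaré's inequality (`norm_toL2_le`) and the orthogonality of curls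
and gradients give the estimate of the theorem (`norm_sq_add_norm_sq_le`). Since `-Δw = ∇ × (∇ ×
w) - ∇ div w`, Laplacians of smooth fields `w` have explicit smooth potentials; they are dense,
and completeness of `H¹` yields potentials of every `v` (`exists_isPotential`).

Orthogonality and uniqueness. Traces are only given as limits, so boundary terms are controlled
when one of the two factors is smooth. Against smooth functions of the right parity one has the
weak forms of `div ∇ = Δ` and `curl curl - ∇ div = -Δ` (`inner_grad_grad`,
`inner_curl_add_inner_div`), so fields annihilated by the differential operators are orthogonal to
all Laplacians, hence zero. This gives uniqueness, and it shows that the `φ` of the decomposition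
of `∇φ` is `φ` itself, a limit of smooth functions; the orthogonality of `∇ × η` and `∇φ` passes
to the limit (`inner_curl_grad`).
-/

namespace VacuumSlab

noncomputable section

/-! ### Calculus of smooth functions on the slab -/

theorem toSpace_smul_add (s t : ℝ) (v : Cover) :
    toSpace ((s + t) • v) = toSpace (s • v) + toSpace (t • v) := by
  rw [add_smul, toSpace_add]

theorem toSpace_zero_smul (v : Cover) : toSpace ((0 : ℝ) • v) = 0 := by
  ext <;> simp [toSpace]

theorem continuous_translate (z : Space) (v : Cover) :
    Continuous fun s : ℝ => z + toSpace (s • v) :=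
  continuous_const.add (isOpenQuotientMap_toSpace.continuous.comp
    (continuous_id.smul continuous_const))

theorem IsSmooth.hasDerivAt_translate {f : Space → ℝ} (hf : IsSmooth f) (i : Fin 3) (z : Space)
    (t : ℝ) : HasDerivAt (fun s : ℝ => f (z + toSpace (s • dir i)))
      (VacuumSlab.pderiv i f (z + toSpace (t • dir i))) t := by
  obtain ⟨x, hx⟩ := isOpenQuotientMap_toSpace.surjective (z + toSpace (t • dir i))
  have h := hf.hasDerivAt i x
  rw [← hf.pderiv_toSpace, hx] at h
  have h' : HasDerivAt (fun s : ℝ => f (z + toSpace (t • dir i) + toSpace (s • dir i)))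
      (VacuumSlab.pderiv i f (z + toSpace (t • dir i))) (t - t) := by simpa using h
  refine (h'.comp_sub_const t t).congr_of_eventuallyEq (Eventually.of_forall fun s => ?_)
  simp only [add_assoc, ← toSpace_smul_add, add_sub_cancel]

theorem IsSmooth.hasDerivAt_zero {f : Space → ℝ} (hf : IsSmooth f) (i : Fin 3) (z : Space) :
    HasDerivAt (fun s : ℝ => f (z + toSpace (s • dir i))) (VacuumSlab.pderiv i f z) 0 := by
  simpa only [toSpace_zero_smul, add_zero] using hf.hasDerivAt_translate i z 0

theorem IsSmooth.mul {f g : Space → ℝ} (hf : IsSmooth f) (hg : IsSmooth g) :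
    IsSmooth (f * g) :=
  ContDiff.mul hf hg

theorem IsSmooth.pderiv_mul {f g : Space → ℝ} (hf : IsSmooth f) (hg : IsSmooth g) (i : Fin 3) :
    VacuumSlab.pderiv i (f * g) = VacuumSlab.pderiv i f * g + f * VacuumSlab.pderiv i g := by
  funext z
  have := ((hf.hasDerivAt_zero i z).mul (hg.hasDerivAt_zero i z)).deriv
  simp only [toSpace_zero_smul, add_zero] at this
  exact this

theorem IsSmooth.pderiv_comm {f : Space → ℝ} (hf : IsSmooth f) (i j : Fin 3) :
    VacuumSlab.pderiv i (VacuumSlab.pderiv j f) = VacuumSlab.pderiv j (VacuumSlab.pderiv i f) := by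
  have key : ∀ (a b : Fin 3) (x : Cover), VacuumSlab.pderiv a (VacuumSlab.pderiv b f) (toSpace x) =
      fderiv ℝ (fderiv ℝ (f ∘ toSpace)) x (dir a) (dir b) := by
    intro a b x
    have h : VacuumSlab.pderiv b f ∘ toSpace = fun x => fderiv ℝ (f ∘ toSpace) x (dir b) :=
      funext fun x => hf.pderiv_toSpace b x
    have hd : DifferentiableAt ℝ (fderiv ℝ (f ∘ toSpace)) x :=
      ((ContDiff.fderiv_right (m := ∞) hf (by simp)).differentiable (by simp)) x
    rw [(hf.pderiv b).pderiv_toSpace, h, fderiv_clm_apply hd (by fun_prop)]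
    simp
  funext z
  obtain ⟨x, rfl⟩ := isOpenQuotientMap_toSpace.surjective z
  rw [key, key]
  have hs : IsSymmSndFDerivAt ℝ (f ∘ toSpace) x :=
    (ContDiff.contDiffAt hf).isSymmSndFDerivAt
      (by simpa using WithTop.coe_le_coe.2 (le_top : (2 : ℕ∞) ≤ ⊤))
  exact hs (dir i) (dir j)

/-- A smooth function of `x₁` alone. -/
theorem isSmooth_comp_fst {χ : ℝ → ℝ} (hχ : ContDiff ℝ ∞ χ) : IsSmooth fun x => χ x.1 :=
  hχ.comp contDiff_fst

theorem pderiv_zero_apply {f : Space → ℝ} (t : ℝ) (y : UnitAddTorus (Fin 2)) :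
    pderiv 0 f (t, y) = deriv (fun s => f (t + s, y)) 0 := by
  have h : ∀ s : ℝ, ((t, y) : Space) + toSpace (s • dir 0) = (t + s, y) := by
    intro s
    ext <;> simp [toSpace, dir]
  simp only [pderiv, h]

theorem dir_succ_fst (j : Fin 2) : (dir j.succ).1 = 0 := by
  fin_cases j <;> rfl

theorem add_toSpace_dir_succ (x : Space) (s : ℝ) (j : Fin 2) :
    x + toSpace (s • dir j.succ) = (x.1, x.2 + (toSpace (s • dir j.succ)).2) := by
  ext <;> simp [toSpace, dir_succ_fst]

theorem IsSmooth.hasDerivAt_fst {f : Space → ℝ} (hf : IsSmooth f) (t : ℝ)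
    (y : UnitAddTorus (Fin 2)) :
    HasDerivAt (fun s => f (s, y)) (VacuumSlab.pderiv 0 f (t, y)) t := by
  have h : ∀ s : ℝ, ((0, y) : Space) + toSpace (s • dir 0) = (s, y) := by
    intro s
    ext <;> simp [toSpace, dir]
  simpa only [h] using hf.hasDerivAt_translate 0 (0, y) t

theorem pderiv_zero_comp_fst (χ : ℝ → ℝ) (x : Space) :
    pderiv 0 (fun x => χ x.1) x = deriv χ x.1 := by
  obtain ⟨t, y⟩ := x
  rw [pderiv_zero_apply, deriv_comp_const_add]
  simp

theorem pderiv_succ_comp_fst (χ : ℝ → ℝ) (j : Fin 2) : pderiv j.succ (fun x => χ x.1) = 0 := by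
  funext x
  simp [pderiv, add_toSpace_dir_succ]

/-! ### Integration over the slab -/

instance : torusMeasure.IsAddLeftInvariant := by
  unfold torusMeasure; infer_instance

theorem ae_mem_Omega : ∀ᵐ x ∂slabMeasure, x ∈ Omega := by
  have h : slabMeasure = (volume.prod torusMeasure).restrict Omega := by
    rw [slabMeasure, Omega, ← Measure.prod_restrict, Measure.restrict_univ]
  rw [h]
  exact ae_restrict_mem (measurableSet_Ioo.prod MeasurableSet.univ)

theorem exists_bound_Omega {f : Space → ℝ} (hf : Continuous f) :
    ∃ C, ∀ x ∈ Omega, ‖f x‖ ≤ C := by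
  obtain ⟨C, hC⟩ := (isCompact_Icc (a := (-1 : ℝ)) (b := 0)).prod
    (isCompact_univ (X := UnitAddTorus (Fin 2))) |>.exists_bound_of_continuousOn hf.continuousOn
  exact ⟨C, fun x hx => hC x ⟨Ioo_subset_Icc_self hx.1, mem_univ _⟩⟩

theorem memLp_slab {f : Space → ℝ} (hf : Continuous f) (p : ℝ≥0∞) : MemLp f p slabMeasure := by
  obtain ⟨C, hC⟩ := exists_bound_Omega hf
  exact MemLp.of_bound hf.aestronglyMeasurable C (ae_mem_Omega.mono hC)

theorem integrable_slab {f : Space → ℝ} (hf : Continuous f) : Integrable f slabMeasure :=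
  memLp_one_iff_integrable.1 (memLp_slab hf 1)

/-- The fundamental theorem of calculus in the direction normal to the boundary. -/
theorem integral_pderiv_zero {f : Space → ℝ} (hf : IsSmooth f) :
    ∫ x, pderiv 0 f x ∂slabMeasure = ∫ y, (f (0, y) - f (-1, y)) ∂torusMeasure := by
  have hi := integrable_slab (hf.pderiv 0).continuous
  rw [slabMeasure] at hi ⊢
  rw [integral_prod_symm _ hi]
  congr 1
  funext y
  rw [integral_Ioc_eq_integral_Ioo.symm, ← intervalIntegral.integral_of_le (by norm_num)]
  refine intervalIntegral.integral_eq_sub_of_hasDerivAt (f := fun t => f (t, y))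
    (fun t _ => hf.hasDerivAt_fst t y) ?_
  exact ((hf.pderiv 0).continuous.comp (by fun_prop : Continuous fun t : ℝ =>
    ((t, y) : Space))).intervalIntegrable _ _

theorem integral_translate_succ {f : Space → ℝ} (hf : Continuous f) (j : Fin 2) (s : ℝ) :
    ∫ x, f (x + toSpace (s • dir j.succ)) ∂slabMeasure = ∫ x, f x ∂slabMeasure := by
  have hi := integrable_slab hf
  have hi' := integrable_slab (f := fun x => f (x + toSpace (s • dir j.succ)))
    (hf.comp (by fun_prop))
  rw [slabMeasure] at hi hi' ⊢
  rw [integral_prod _ hi, integral_prod _ hi']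
  congr 1
  funext t
  simp only [add_toSpace_dir_succ]
  exact integral_add_right_eq_self (fun y => f (t, y)) _

theorem toSpace_dir_succ (j : Fin 2) : toSpace ((1 : ℝ) • dir j.succ) = 0 := by
  refine Prod.ext (by simp [toSpace, dir_succ_fst]) (funext fun i => ?_)
  fin_cases j <;> fin_cases i <;> simp [toSpace, dir]

/-- A tangential derivative has integral zero: its average over a period of translations vanishes
pointwise, and the translations preserve the measure. -/
theorem integral_pderiv_succ {f : Space → ℝ} (hf : IsSmooth f) (j : Fin 2) :
    ∫ x, pderiv j.succ f x ∂slabMeasure = 0 := by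
  have hc : Continuous (pderiv j.succ f) := (hf.pderiv _).continuous
  have hc2 : Continuous fun p : Space × ℝ => pderiv j.succ f (p.1 + toSpace (p.2 • dir j.succ)) :=
    hc.comp (continuous_fst.add (isOpenQuotientMap_toSpace.continuous.comp
      (continuous_snd.smul continuous_const)))
  have h0 : ∀ x, ∫ s in (0 : ℝ)..1, pderiv j.succ f (x + toSpace (s • dir j.succ)) = 0 := by
    intro x
    rw [intervalIntegral.integral_eq_sub_of_hasDerivAt
      (f := fun s => f (x + toSpace (s • dir j.succ)))
      (fun s _ => hf.hasDerivAt_translate j.succ x s)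
      ((hc.comp (continuous_translate x _)).intervalIntegrable _ _)]
    rw [toSpace_dir_succ, toSpace_zero_smul, sub_self]
  have hint : Integrable (Function.uncurry fun (x : Space) (s : ℝ) =>
      pderiv j.succ f (x + toSpace (s • dir j.succ)))
      (slabMeasure.prod (volume.restrict (Ioc (0 : ℝ) 1))) := by
    obtain ⟨C, hC⟩ := ((isCompact_Icc (a := (-1 : ℝ)) (b := 0)).prod
      (isCompact_univ (X := UnitAddTorus (Fin 2)))).exists_bound_of_continuousOn hc.continuousOn
    refine memLp_one_iff_integrable.1
      (MemLp.of_bound (hc2.aestronglyMeasurable) C ?_)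
    refine (Measure.ae_prod_iff_ae_ae ?_).2 ?_
    · exact (measurableSet_le hc2.norm.measurable measurable_const)
    · filter_upwards [ae_mem_Omega] with x hx
      refine Eventually.of_forall fun s => hC _ ?_
      rw [add_toSpace_dir_succ]
      exact ⟨Ioo_subset_Icc_self hx.1, mem_univ _⟩
  have h1 := integral_integral_swap hint
  simp only [integral_translate_succ hc] at h1
  simp only [← intervalIntegral.integral_of_le (zero_le_one (α := ℝ)), h0] at h1
  simpa using h1.symm

/-! ### Smooth functions as elements of `L²` and `H¹` -/

/-- The space of smooth functions on `ℝ × 𝕋²`. -/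
def Smooth : Submodule ℝ (Space → ℝ) where
  carrier := {f | IsSmooth f}
  add_mem' hf hg := IsSmooth.add hf hg
  zero_mem' := IsSmooth.zero
  smul_mem' c _ hf := IsSmooth.smul c hf

theorem isSmooth (f : Smooth) : IsSmooth f.1 := f.2

/-- The classical partial derivative, as an operator on smooth functions. -/
def D (i : Fin 3) : Smooth →ₗ[ℝ] Smooth where
  toFun f := ⟨pderiv i f.1, (isSmooth f).pderiv i⟩
  map_add' f g := Subtype.ext ((isSmooth f).pderiv_add (isSmooth g) i)
  map_smul' c f := Subtype.ext ((isSmooth f).pderiv_smul c i)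

theorem D_comm (i j : Fin 3) (f : Smooth) : D i (D j f) = D j (D i f) :=
  Subtype.ext ((isSmooth f).pderiv_comm i j)

/-- A smooth function, restricted to `Ω⁻`, as an element of `L²`. -/
def toL2 : Smooth →ₗ[ℝ] L2 where
  toFun f := (memLp_slab (isSmooth f).continuous 2).toLp f.1
  map_add' f g := MemLp.toLp_add (memLp_slab (isSmooth f).continuous 2)
    (memLp_slab (isSmooth g).continuous 2)
  map_smul' c f := MemLp.toLp_const_smul c (memLp_slab (isSmooth f).continuous 2)

theorem coeFn_toL2 (f : Smooth) : toL2 f =ᵐ[slabMeasure] f.1 :=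
  MemLp.coeFn_toLp (memLp_slab (isSmooth f).continuous 2)

theorem inner_toL2 (u : L2) (g : Smooth) :
    inner ℝ u (toL2 g) = ∫ x, u x * g.1 x ∂slabMeasure := by
  rw [L2.inner_def]
  refine integral_congr_ae ?_
  filter_upwards [coeFn_toL2 g] with x hx
  simp [hx, mul_comm]

theorem inner_toL2_toL2 (f g : Smooth) :
    inner ℝ (toL2 f) (toL2 g) = ∫ x, f.1 x * g.1 x ∂slabMeasure := by
  rw [inner_toL2]
  refine integral_congr_ae ?_
  filter_upwards [coeFn_toL2 f] with x hx
  rw [hx]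

theorem inner_D_add (i : Fin 3) (f g : Smooth) :
    inner ℝ (toL2 (D i f)) (toL2 g) + inner ℝ (toL2 f) (toL2 (D i g)) =
      ∫ x, pderiv i (f.1 * g.1) x ∂slabMeasure := by
  rw [inner_toL2_toL2, inner_toL2_toL2, (isSmooth f).pderiv_mul (isSmooth g), ← integral_add]
  · rfl
  · exact integrable_slab ((isSmooth (D i f)).continuous.mul (isSmooth g).continuous)
  · exact integrable_slab ((isSmooth f).continuous.mul (isSmooth (D i g)).continuous)

/-- Integration by parts in the normal direction, with the boundary terms on `Γ` and `Γ₋`. -/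
theorem inner_D_zero_add (f g : Smooth) :
    inner ℝ (toL2 (D 0 f)) (toL2 g) + inner ℝ (toL2 f) (toL2 (D 0 g)) =
      ∫ y, f.1 (0, y) * g.1 (0, y) ∂torusMeasure -
        ∫ y, f.1 (-1, y) * g.1 (-1, y) ∂torusMeasure := by
  have h : ∀ a : ℝ, Integrable (fun y => f.1 (a, y) * g.1 (a, y)) torusMeasure := by
    intro a
    have hc : Continuous fun y : UnitAddTorus (Fin 2) => f.1 (a, y) * g.1 (a, y) :=
      ((isSmooth f).continuous.comp (by fun_prop)).mul ((isSmooth g).continuous.comp (by fun_prop))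
    exact hc.integrable_of_hasCompactSupport (HasCompactSupport.of_compactSpace _)
  rw [inner_D_add, integral_pderiv_zero ((isSmooth f).mul (isSmooth g)),
    ← integral_sub (h 0) (h (-1))]
  rfl

theorem inner_D_succ_add (j : Fin 2) (f g : Smooth) :
    inner ℝ (toL2 (D j.succ f)) (toL2 g) + inner ℝ (toL2 f) (toL2 (D j.succ g)) = 0 := by
  rw [inner_D_add, integral_pderiv_succ ((isSmooth f).mul (isSmooth g))]

theorem comp_inComp (i j : Fin 3) (u : L2) : comp i (inComp j u) = if i = j then u else 0 := by
  have h : comp i (inComp j u) =ᵐ[slabMeasure] fun x => if i = j then u x else 0 := by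
    filter_upwards [ContinuousLinearMap.coeFn_compLpL (p := 2) (μ := slabMeasure)
      (EuclideanSpace.proj i : EuclideanSpace ℝ (Fin 3) →L[ℝ] ℝ) (inComp j u),
      ContinuousLinearMap.coeFn_compLpL (p := 2) (μ := slabMeasure)
      (ContinuousLinearMap.toSpanSingleton ℝ (EuclideanSpace.single j (1 : ℝ))) u] with x h1 h2
    rw [comp, h1, inComp, h2]
    simp
  ext1
  refine h.trans ?_
  split_ifs
  · rfl
  · exact (Lp.coeFn_zero _ _ _).symm

/-- The `L²` vector field with given components. -/
def field (w : Fin 3 → L2) : L2Field := ∑ i, inComp i (w i)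

theorem comp_field (w : Fin 3 → L2) (i : Fin 3) : comp i (field w) = w i := by
  simp [field, comp_inComp]

theorem IsTest.eq_zero_of_notMem {ψ : Space → ℝ} (h : IsTest ψ) {x : Space} (hx : x ∉ Omega) :
    ψ x = 0 :=
  image_eq_zero_of_notMem_tsupport fun h' => hx (h.2.2 h')

theorem isWeakGrad_smooth (f : Smooth) :
    IsWeakGrad (toL2 f) (field fun i => toL2 (D i f)) := by
  intro ψ hψ i
  obtain ⟨g, rfl⟩ : ∃ g : Smooth, g.1 = ψ := ⟨⟨ψ, hψ.1⟩, rfl⟩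
  have h := inner_toL2 (toL2 f) (D i g)
  rw [comp_field, ← inner_toL2, eq_neg_iff_add_eq_zero]
  refine (congrArg (· + _) h).symm.trans ?_
  rw [add_comm]
  refine Fin.cases ?_ (fun j => ?_) i
  · have hb : ∀ a : ℝ, a = 0 ∨ a = -1 → ∀ y, g.1 (a, y) = 0 := by
      rintro a ha y
      refine hψ.eq_zero_of_notMem fun h => ?_
      rcases ha with rfl | rfl <;> simp [Omega] at h
    simp [inner_D_zero_add, hb]
  · exact inner_D_succ_add j f g

/-- A smooth function, restricted to `Ω⁻`, as an element of `H¹`. -/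
def toH1 : Smooth →ₗ[ℝ] H1 where
  toFun f := ⟨WithLp.toLp 2 (toL2 f, field fun i => toL2 (D i f)), isWeakGrad_smooth f⟩
  map_add' f g := by
    refine Subtype.ext ?_
    change _ = WithLp.toLp 2 ((_, _) + (_, _))
    simp [field, Finset.sum_add_distrib]
  map_smul' c f := by
    refine Subtype.ext ?_
    change _ = WithLp.toLp 2 (c • (_, _))
    simp [field, Finset.smul_sum]

@[simp] theorem fn_toH1 (f : Smooth) : fn (toH1 f) = toL2 f := rfl

@[simp] theorem partialD_toH1 (i : Fin 3) (f : Smooth) : partialD i (toH1 f) = toL2 (D i f) :=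
  comp_field _ i

theorem mem_vanishingOn_toH1 {a : ℝ} {f : Smooth} (hf : ∀ y, f.1 (a, y) = 0) :
    toH1 f ∈ vanishingOn a := by
  have h : ∀ g : Smooth, eLpNorm (⇑(toL2 g) - g.1) 2 slabMeasure = 0 := fun g => by
    rw [eLpNorm_congr_ae ((coeFn_toL2 g).sub EventuallyEq.rfl), sub_self, eLpNorm_zero]
  refine ⟨fun _ => f.1, fun _ => (isSmooth f), ?_, fun i => ?_, ?_⟩
  · simp [h]
  · rw [partialD_toH1]
    have := h (D i f)
    exact (tendsto_congr fun _ => this).2 tendsto_const_nhds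
  · have : ((fun y => f.1 (a, y)) - 0 : UnitAddTorus (Fin 2) → ℝ) = 0 := by
      funext y; simp [hf]
    simp [this]

/-! ### Integration by parts against smooth functions -/

/-- Smooth cutoff functions of `x₁`, supported in `(-1, 0)` and increasing to `1` there. -/
def cutoff (n : ℕ) (t : ℝ) : ℝ :=
  Real.smoothTransition ((n + 1) * (t + 1) - 1) * Real.smoothTransition (-((n + 1) * t) - 1)

theorem contDiff_cutoff (n : ℕ) : ContDiff ℝ ∞ (cutoff n) := by
  unfold cutoff
  exact (Real.smoothTransition.contDiff.comp (by fun_prop)).mul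
    (Real.smoothTransition.contDiff.comp (by fun_prop))

theorem cutoff_eq_zero {n : ℕ} {t : ℝ}
    (h : t ∉ Icc (-1 + 1 / ((n : ℝ) + 1)) (-(1 / ((n : ℝ) + 1)))) : cutoff n t = 0 := by
  have hn : (0 : ℝ) < n + 1 := by positivity
  have e : ((n : ℝ) + 1) * (1 / ((n : ℝ) + 1)) = 1 := by field_simp
  rw [mem_Icc, not_and_or, not_le, not_le] at h
  rcases h with h | h
  · rw [cutoff, Real.smoothTransition.zero_of_nonpos (by nlinarith), zero_mul]
  · rw [cutoff, Real.smoothTransition.zero_of_nonpos (x := -((n + 1) * t) - 1) (by nlinarith),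
      mul_zero]

theorem norm_cutoff_le (n : ℕ) (t : ℝ) : ‖cutoff n t‖ ≤ 1 := by
  rw [cutoff, norm_mul, Real.norm_of_nonneg (Real.smoothTransition.nonneg _),
    Real.norm_of_nonneg (Real.smoothTransition.nonneg _)]
  exact mul_le_one₀ (Real.smoothTransition.le_one _) (Real.smoothTransition.nonneg _)
    (Real.smoothTransition.le_one _)

theorem tendsto_cutoff {t : ℝ} (ht : t ∈ Ioo (-1 : ℝ) 0) :
    Tendsto (fun n => cutoff n t) atTop (𝓝 1) := by
  have h1 : Tendsto (fun n : ℕ => ((n : ℝ) + 1) * (t + 1) - 1) atTop atTop :=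
    tendsto_atTop_add_const_right _ _ ((tendsto_atTop_add_const_right _ _
      tendsto_natCast_atTop_atTop).atTop_mul_const (by linarith [ht.1]))
  have h2 : Tendsto (fun n : ℕ => -(((n : ℝ) + 1) * t) - 1) atTop atTop := by
    simp only [← mul_neg]
    exact tendsto_atTop_add_const_right _ _ ((tendsto_atTop_add_const_right _ _
      tendsto_natCast_atTop_atTop).atTop_mul_const (by linarith [ht.2]))
  refine tendsto_const_nhds.congr' ?_
  filter_upwards [h1.eventually_ge_atTop 1, h2.eventually_ge_atTop 1] with n a b
  rw [cutoff, Real.smoothTransition.one_of_one_le a, Real.smoothTransition.one_of_one_le b, one_mul]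

theorem isTest_cutoff_mul (n : ℕ) (g : Smooth) :
    IsTest ((fun x => cutoff n x.1) * g.1) := by
  set K : Set Space := Icc (-1 + 1 / ((n : ℝ) + 1)) (-(1 / ((n : ℝ) + 1))) ×ˢ univ with hK
  have hKc : IsCompact K := isCompact_Icc.prod isCompact_univ
  have hsupp : tsupport ((fun x : Space => cutoff n x.1) * g.1) ⊆ K := by
    refine closure_minimal (fun x hx => ?_) hKc.isClosed
    by_contra hx'
    refine hx ?_
    have : cutoff n x.1 = 0 := cutoff_eq_zero fun h => hx' ⟨h, mem_univ _⟩
    simp [this]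
  refine ⟨(isSmooth_comp_fst (contDiff_cutoff n)).mul (isSmooth g),
    hKc.of_isClosed_subset (isClosed_tsupport _) hsupp, hsupp.trans fun x hx => ⟨?_, mem_univ _⟩⟩
  have hn : 0 < 1 / ((n : ℝ) + 1) := by positivity
  exact ⟨by linarith [hx.1.1], by linarith [hx.1.2]⟩

theorem tendsto_integral_cutoff {h : Space → ℝ} (hh : Integrable h slabMeasure) :
    Tendsto (fun n => ∫ x, h x * cutoff n x.1 ∂slabMeasure) atTop (𝓝 (∫ x, h x ∂slabMeasure)) := by
  refine tendsto_integral_of_dominated_convergence (fun x => ‖h x‖) (fun n => ?_) hh.norm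
    (fun n => Eventually.of_forall fun x => ?_) ?_
  · exact hh.aestronglyMeasurable.mul
      ((isSmooth_comp_fst (contDiff_cutoff n)).aestronglyMeasurable _)
  · rw [norm_mul]
    exact mul_le_of_le_one_right (norm_nonneg _) (norm_cutoff_le n _)
  · filter_upwards [ae_mem_Omega] with x hx
    simpa using (tendsto_cutoff hx.1).const_mul (h x)

/-- Integration by parts in a tangential direction. No boundary condition is needed: a cutoff in
`x₁` commutes with the tangential derivatives. -/
theorem inner_partialD_succ (j : Fin 2) (u : H1) (g : Smooth) :
    inner ℝ (partialD j.succ u) (toL2 g) = -inner ℝ (fn u) (toL2 (D j.succ g)) := by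
  rw [inner_toL2, inner_toL2]
  have h1 := tendsto_integral_cutoff ((Lp.memLp (fn u)).integrable_mul
    (memLp_slab (isSmooth (D j.succ g)).continuous 2))
  have h2 := tendsto_integral_cutoff ((Lp.memLp (partialD j.succ u)).integrable_mul
    (memLp_slab (isSmooth g).continuous 2))
  refine tendsto_nhds_unique h2 (h1.neg.congr fun n => ?_)
  have h := u.2 _ (isTest_cutoff_mul n g) j.succ
  rw [(isSmooth_comp_fst (contDiff_cutoff n)).pderiv_mul (isSmooth g),
    pderiv_succ_comp_fst, zero_mul, zero_add] at h
  rw [neg_eq_iff_eq_neg]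
  refine Eq.trans (integral_congr_ae (Eventually.of_forall fun x => ?_)) (h.trans
    (congrArg _ (integral_congr_ae (Eventually.of_forall fun x => ?_))))
  · simp only [Pi.mul_apply, mul_assoc]
    exact congrArg _ (mul_comm _ _)
  · simp only [Pi.mul_apply, mul_assoc]
    exact congrArg _ (mul_comm _ _)

theorem tendsto_toL2 {u : L2} {f : ℕ → Smooth} :
    Tendsto (fun n => toL2 (f n)) atTop (𝓝 u) ↔
      Tendsto (fun n => eLpNorm (⇑u - (f n).1) 2 slabMeasure) atTop (𝓝 0) := by
  rw [Lp.tendsto_Lp_iff_tendsto_eLpNorm']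
  refine tendsto_congr fun n => ?_
  rw [eLpNorm_sub_comm]
  exact eLpNorm_congr_ae (EventuallyEq.rfl.sub (coeFn_toL2 (f n)))

/-- A vanishing trace enters the argument only through pairings of the boundary values of the
approximating functions with a fixed smooth function. -/
theorem exists_tendsto_of_mem_vanishingOn {a : ℝ} {u : H1} (hu : u ∈ vanishingOn a) :
    ∃ f : ℕ → Smooth, Tendsto (fun n => toL2 (f n)) atTop (𝓝 (fn u)) ∧
      (∀ i, Tendsto (fun n => toL2 (D i (f n))) atTop (𝓝 (partialD i u))) ∧
      ∀ g : Smooth, Tendsto (fun n => ∫ y, (f n).1 (a, y) * g.1 (a, y) ∂torusMeasure) atTop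
        (𝓝 0) := by
  obtain ⟨f, hf, h1, h2, h3⟩ := hu
  refine ⟨fun n => ⟨f n, hf n⟩, tendsto_toL2.2 h1, fun i => tendsto_toL2.2 (h2 i), fun g => ?_⟩
  have hc : ∀ h : Smooth, Continuous fun y : UnitAddTorus (Fin 2) => h.1 (a, y) := fun h =>
    (isSmooth h).continuous.comp (by fun_prop)
  obtain ⟨C, hC⟩ := isCompact_univ.exists_bound_of_continuousOn (hc g).continuousOn
  have hint : ∀ n, Integrable (fun y => f n (a, y) * g.1 (a, y)) torusMeasure := fun n =>
    ((hc ⟨f n, hf n⟩).mul (hc g)).integrable_of_hasCompactSupport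
      (HasCompactSupport.of_compactSpace _)
  have hl := tendsto_integral_of_L1' (μ := torusMeasure) (l := atTop) (fun _ => (0 : ℝ))
    aestronglyMeasurable_const (F := fun n y => f n (a, y) * g.1 (a, y))
    (Eventually.of_forall hint) ?_
  · simpa using hl
  have hle : ∀ n, eLpNorm ((fun y => f n (a, y) * g.1 (a, y)) - fun _ => (0 : ℝ)) 1 torusMeasure ≤
      ENNReal.ofReal C * eLpNorm ((fun y => f n (a, y)) - 0) 2 torusMeasure := by
    intro n
    refine (eLpNorm_le_mul_eLpNorm_of_ae_le_mul (g := (fun y => f n (a, y)) - 0) (c := C)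
      (Eventually.of_forall fun y => ?_) 1).trans ?_
    · simp only [Pi.sub_apply, Pi.zero_apply, sub_zero, norm_mul]
      rw [mul_comm]
      exact mul_le_mul_of_nonneg_right (hC y (mem_univ _)) (norm_nonneg _)
    · gcongr
      refine eLpNorm_le_eLpNorm_of_exponent_le (by norm_num) ?_
      simpa using (hc ⟨f n, hf n⟩).aestronglyMeasurable
  refine tendsto_of_tendsto_of_tendsto_of_le_of_le tendsto_const_nhds ?_ (fun _ => zero_le) hle
  simpa using ENNReal.Tendsto.const_mul h3 (Or.inr ENNReal.ofReal_ne_top)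

theorem inner_partialD_zero_of_mem_vanishingOn_neg_one {u : H1} (hu : u ∈ vanishingOn (-1))
    {g : Smooth} (hg : ∀ y, g.1 (0, y) = 0) :
    inner ℝ (partialD 0 u) (toL2 g) = -inner ℝ (fn u) (toL2 (D 0 g)) := by
  obtain ⟨f, h0, h1, h2⟩ := exists_tendsto_of_mem_vanishingOn hu
  have ha := Tendsto.add ((h1 0).inner (𝕜 := ℝ) (tendsto_const_nhds (x := toL2 g)))
    (h0.inner (𝕜 := ℝ) (tendsto_const_nhds (x := toL2 (D 0 g))))
  rw [← add_eq_zero_iff_eq_neg]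
  refine tendsto_nhds_unique ha ?_
  simp only [inner_D_zero_add, hg, mul_zero, integral_zero, zero_sub]
  simpa using (h2 g).neg

theorem inner_partialD_zero_of_mem_vanishingOn_zero {u : H1} (hu : u ∈ vanishingOn 0)
    {g : Smooth} (hg : ∀ y, g.1 (-1, y) = 0) :
    inner ℝ (partialD 0 u) (toL2 g) = -inner ℝ (fn u) (toL2 (D 0 g)) := by
  obtain ⟨f, h0, h1, h2⟩ := exists_tendsto_of_mem_vanishingOn hu
  have ha := Tendsto.add ((h1 0).inner (𝕜 := ℝ) (tendsto_const_nhds (x := toL2 g)))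
    (h0.inner (𝕜 := ℝ) (tendsto_const_nhds (x := toL2 (D 0 g))))
  rw [← add_eq_zero_iff_eq_neg]
  refine tendsto_nhds_unique ha ?_
  simp only [inner_D_zero_add, hg, mul_zero, integral_zero, sub_zero]
  exact h2 g

/-! ### Parity under the reflections in the boundary -/

/-- The smooth functions `f` with `f(-x₁, x') = ε f(x₁, x')` and `f(-2 - x₁, x') = -ε f(x₁, x')`.
For `ε = 1` they are even about `Γ` and odd about `Γ₋`; for `ε = -1` it is the other way round. -/
def parity (ε : ℝ) : Submodule ℝ Smooth where
  carrier := {f | (∀ t y, f.1 (-t, y) = ε * f.1 (t, y)) ∧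
    ∀ t y, f.1 (-2 - t, y) = -(ε * f.1 (t, y))}
  add_mem' := by
    rintro f g ⟨hf, hf'⟩ ⟨hg, hg'⟩
    refine ⟨fun t y => ?_, fun t y => ?_⟩
    · have := hf t y
      have := hg t y
      simp only [Submodule.coe_add, Pi.add_apply]
      linarith
    · have := hf' t y
      have := hg' t y
      simp only [Submodule.coe_add, Pi.add_apply]
      linarith
  zero_mem' := ⟨fun t y => by simp, fun t y => by simp⟩
  smul_mem' := by
    rintro c f ⟨hf, hf'⟩
    refine ⟨fun t y => ?_, fun t y => ?_⟩
    · simp only [Submodule.coe_smul, Pi.smul_apply, smul_eq_mul, hf t y]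
      ring
    · simp only [Submodule.coe_smul, Pi.smul_apply, smul_eq_mul, hf' t y]
      ring

theorem eq_zero_of_parity_one {f : Smooth} (hf : f ∈ parity 1) (y : UnitAddTorus (Fin 2)) :
    f.1 (-1, y) = 0 := by
  have h := hf.2 (-1) y
  norm_num at h
  linarith

theorem eq_zero_of_parity_neg_one {f : Smooth} (hf : f ∈ parity (-1))
    (y : UnitAddTorus (Fin 2)) : f.1 (0, y) = 0 := by
  have h := hf.1 0 y
  norm_num at h
  linarith

theorem D_zero_mem_parity {ε ε' : ℝ} (hε : ε' = -ε) {f : Smooth} (hf : f ∈ parity ε) :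
    D 0 f ∈ parity ε' := by
  subst hε
  refine ⟨fun t y => ?_, fun t y => ?_⟩
  · have h1 := ((isSmooth f).hasDerivAt_fst (-t) y).scomp t (hasDerivAt_neg t)
    have h2 : HasDerivAt ((fun s => f.1 (s, y)) ∘ Neg.neg) (ε * pderiv 0 f.1 (t, y)) t :=
      (((isSmooth f).hasDerivAt_fst t y).const_mul ε).congr_of_eventuallyEq
        (Eventually.of_forall fun s => hf.1 s y)
    have := h1.unique h2
    simp only [smul_eq_mul] at this
    change pderiv 0 f.1 (-t, y) = -ε * pderiv 0 f.1 (t, y)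
    linarith
  · have h1 := ((isSmooth f).hasDerivAt_fst (-2 - t) y).scomp t
      ((hasDerivAt_id t).const_sub (-2))
    have h2 : HasDerivAt ((fun s => f.1 (s, y)) ∘ fun s => -2 - s)
        (-(ε * pderiv 0 f.1 (t, y))) t :=
      (((isSmooth f).hasDerivAt_fst t y).const_mul ε).neg.congr_of_eventuallyEq
        (Eventually.of_forall fun s => hf.2 s y)
    have := h1.unique h2
    simp only [smul_eq_mul] at this
    change pderiv 0 f.1 (-2 - t, y) = -(-ε * pderiv 0 f.1 (t, y))
    linarith

theorem D_succ_mem_parity {ε : ℝ} (j : Fin 2) {f : Smooth} (hf : f ∈ parity ε) :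
    D j.succ f ∈ parity ε := by
  refine ⟨fun t y => ?_, fun t y => ?_⟩
  · change pderiv j.succ f.1 (-t, y) = ε * pderiv j.succ f.1 (t, y)
    simp only [pderiv, add_toSpace_dir_succ, hf.1]
    exact deriv_const_mul_field ε
  · change pderiv j.succ f.1 (-2 - t, y) = -(ε * pderiv j.succ f.1 (t, y))
    simp only [pderiv, add_toSpace_dir_succ, hf.2]
    rw [deriv.fun_neg, deriv_const_mul_field]

/-- The Laplacian on smooth functions. -/
def lap : Smooth →ₗ[ℝ] Smooth := ∑ i, D i ∘ₗ D i

theorem lap_apply (f : Smooth) : lap f = ∑ i, D i (D i f) := by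
  simp [lap]

theorem lap_mem_parity {ε : ℝ} {f : Smooth} (hf : f ∈ parity ε) : lap f ∈ parity ε := by
  rw [lap_apply]
  refine Submodule.sum_mem _ fun i _ => ?_
  refine Fin.cases ?_ (fun j => ?_) i
  · exact D_zero_mem_parity (neg_neg ε).symm (D_zero_mem_parity rfl hf)
  · exact D_succ_mem_parity j (D_succ_mem_parity j hf)

/-! ### Eigenfunctions of the Laplacian and their completeness -/

open UnitAddTorus in
theorem mFourier_toSpace (k : Fin 2 → ℤ) (x : Cover) :
    mFourier k (toSpace x).2 =
      Complex.exp (2 * Real.pi * Complex.I * (k 0 * x.2 0 + k 1 * x.2 1)) := by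
  simp only [mFourier, ContinuousMap.coe_mk, Fin.prod_univ_two, toSpace, fourier_coe_apply,
    ← Complex.exp_add]
  congr 1
  push_cast
  ring

open UnitAddTorus in
theorem mFourier_add_arg (k : Fin 2 → ℤ) (y z : UnitAddTorus (Fin 2)) :
    mFourier k (y + z) = mFourier k y * mFourier k z := by
  simp only [mFourier, ContinuousMap.coe_mk, ← Finset.prod_mul_distrib, fourier_apply,
    Pi.add_apply, smul_add, AddCircle.toCircle_add, Circle.coe_mul]

open UnitAddTorus in
/-- The function `cos((n + 1/2)π(x₁ + 1) - α) Re(c exp(2πi k·x'))`. The half-integer frequencies are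
those of the functions with a parity in `x₁`. -/
def mode (α : ℝ) (n : ℤ) (k : Fin 2 → ℤ) (c : ℂ) : Smooth :=
  ⟨fun x => Real.cos ((n + 1 / 2) * Real.pi * (x.1 + 1) - α) * (c * mFourier k x.2).re, by
    have h : ContDiff ℝ ∞ fun x : Cover => Real.cos ((n + 1 / 2) * Real.pi * (x.1 + 1) - α) *
        (c * Complex.exp (2 * Real.pi * Complex.I * (k 0 * x.2 0 + k 1 * x.2 1))).re := by
      refine ContDiff.mul (by fun_prop) ?_
      refine Complex.reCLM.contDiff.comp (contDiff_const.mul (ContDiff.cexp ?_))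
      have h : ∀ i, ContDiff ℝ ∞ fun x : Cover => (x.2 i : ℂ) := fun i =>
        Complex.ofRealCLM.contDiff.comp (by fun_prop)
      exact contDiff_const.mul ((contDiff_const.mul (h 0)).add (contDiff_const.mul (h 1)))
    refine (congrArg (ContDiff ℝ ∞) (funext fun x => ?_)).mpr h
    simp only [Function.comp_apply, mFourier_toSpace]
    rfl⟩

open UnitAddTorus in
theorem mode_apply (α : ℝ) (n : ℤ) (k : Fin 2 → ℤ) (c : ℂ) (x : Space) :
    (mode α n k c).1 x =
      Real.cos ((n + 1 / 2) * Real.pi * (x.1 + 1) - α) * (c * mFourier k x.2).re := rfl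

theorem mode_mem_parity {α ε : ℝ} (h : ∀ x, Real.cos (x + α) = -(ε * Real.cos (x - α))) (n : ℤ)
    (k : Fin 2 → ℤ) (c : ℂ) : mode α n k c ∈ parity ε := by
  refine ⟨fun t y => ?_, fun t y => ?_⟩
  · have e : ((n : ℝ) + 1 / 2) * Real.pi * (-t + 1) - α =
        Real.pi - ((n + 1 / 2) * Real.pi * (t + 1) + α) + n * (2 * Real.pi) := by ring
    rw [mode_apply, mode_apply, e, Real.cos_add_int_mul_two_pi, Real.cos_pi_sub, h]
    ring
  · have e : ((n : ℝ) + 1 / 2) * Real.pi * (-2 - t + 1) - α =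
        -((n + 1 / 2) * Real.pi * (t + 1) + α) := by ring
    rw [mode_apply, mode_apply, e, Real.cos_neg, h]
    ring

theorem D_zero_mode (α : ℝ) (n : ℤ) (k : Fin 2 → ℤ) (c : ℂ) :
    D 0 (mode α n k c) = -((n + 1 / 2) * Real.pi) • mode (α + Real.pi / 2) n k c := by
  refine Subtype.ext (funext fun ⟨t, y⟩ => ?_)
  refine ((isSmooth (mode α n k c)).hasDerivAt_fst t y).unique ?_
  have h1 : HasDerivAt (fun s : ℝ => ((n : ℝ) + 1 / 2) * Real.pi * (s + 1) - α)
      (((n : ℝ) + 1 / 2) * Real.pi) t := by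
    simpa using
      (((hasDerivAt_id t).add_const 1).const_mul (((n : ℝ) + 1 / 2) * Real.pi)).sub_const α
  convert! h1.cos.mul_const (c * UnitAddTorus.mFourier k y).re using 1
  simp only [Submodule.coe_smul, Pi.smul_apply, mode_apply, smul_eq_mul, ← sub_sub,
    Real.cos_sub_pi_div_two]
  ring

theorem D_succ_mode (j : Fin 2) (α : ℝ) (n : ℤ) (k : Fin 2 → ℤ) (c : ℂ) :
    D j.succ (mode α n k c) = mode α n k (2 * Real.pi * Complex.I * k j * c) := by
  refine Subtype.ext (funext fun x => ?_)
  refine ((isSmooth (mode α n k c)).hasDerivAt_zero j.succ x).unique ?_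
  have e : ∀ s : ℝ, UnitAddTorus.mFourier k (toSpace (s • dir j.succ)).2 =
      Complex.exp (2 * Real.pi * Complex.I * k j * s) := by
    intro s
    rw [mFourier_toSpace]
    fin_cases j <;> simp [dir, mul_assoc]
  simp only [add_toSpace_dir_succ, mode_apply, mFourier_add_arg, e]
  refine HasDerivAt.const_mul _ ?_
  have h1 : HasDerivAt (fun s : ℝ => Complex.exp (2 * Real.pi * Complex.I * k j * s))
      (2 * Real.pi * Complex.I * k j) 0 := by
    have := (((Complex.ofRealCLM.hasDerivAt (x := (0 : ℝ))).const_mul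
      (2 * Real.pi * Complex.I * k j : ℂ))).cexp
    simpa using this
  have h2 := Complex.reCLM.hasFDerivAt.comp_hasDerivAt (0 : ℝ)
    (h1.const_mul (c * UnitAddTorus.mFourier k x.2))
  convert! h2 using 1
  · funext s
    simp only [Function.comp_apply, Complex.reCLM_apply, mul_assoc]
  · simp only [Complex.reCLM_apply]
    congr 1
    ring

theorem mode_smul (r : ℝ) (α : ℝ) (n : ℤ) (k : Fin 2 → ℤ) (c : ℂ) :
    mode α n k (r * c) = r • mode α n k c := by
  refine Subtype.ext (funext fun x => ?_)
  simp only [mode_apply, Submodule.coe_smul, Pi.smul_apply, smul_eq_mul, mul_assoc,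
    Complex.re_ofReal_mul]
  ring

theorem lap_mode (α : ℝ) (n : ℤ) (k : Fin 2 → ℤ) (c : ℂ) :
    lap (mode α n k c) = -(((n + 1 / 2) * Real.pi) ^ 2 + (2 * Real.pi * k 0) ^ 2 +
      (2 * Real.pi * k 1) ^ 2) • mode α n k c := by
  have h0 : D 0 (D 0 (mode α n k c)) = -((n + 1 / 2) * Real.pi) ^ 2 • mode α n k c := by
    have e : mode (α + Real.pi / 2 + Real.pi / 2) n k c = -mode α n k c := by
      refine Subtype.ext (funext fun x => ?_)
      simp only [mode_apply, ← sub_sub, Submodule.coe_neg, Pi.neg_apply,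
        Real.cos_sub_pi_div_two, Real.sin_sub_pi_div_two]
      ring
    rw [D_zero_mode, map_smul, D_zero_mode, e]
    module
  have h1 : ∀ j : Fin 2, D j.succ (D j.succ (mode α n k c)) =
      -(2 * Real.pi * k j) ^ 2 • mode α n k c := by
    intro j
    rw [D_succ_mode, D_succ_mode, ← mode_smul]
    congr 1
    push_cast
    linear_combination (2 * Real.pi * k j : ℂ) ^ 2 * c * Complex.I_sq
  rw [lap_apply, Fin.sum_univ_three, h0, show (1 : Fin 3) = (0 : Fin 2).succ from rfl,
    show (2 : Fin 3) = (1 : Fin 2).succ from rfl, h1, h1]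
  module

/-- The eigenvalues are nonzero because the normal frequencies are half-integers. -/
theorem lap_mode_coeff_ne_zero (n : ℤ) (a b : ℝ) :
    -(((n + 1 / 2) * Real.pi) ^ 2 + a ^ 2 + b ^ 2) ≠ 0 := by
  have hn : ((n : ℝ) + 1 / 2) ≠ 0 := by
    intro h
    have : (2 * n + 1 : ℤ) = 0 := by
      have : (2 * (n : ℝ) + 1) = 0 := by linarith
      exact_mod_cast this
    omega
  have : 0 < (((n : ℝ) + 1 / 2) * Real.pi) ^ 2 := by
    have := Real.pi_ne_zero
    positivity
  nlinarith [sq_nonneg a, sq_nonneg b]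

/-- The compact model `[-1, 0] × 𝕋²` of the closed slab. -/
abbrev ClosedSlab : Type := Icc (-1 : ℝ) 0 × UnitAddTorus (Fin 2)

/-- The inclusion of the closed slab. -/
def slabIncl : C(ClosedSlab, Space) := ⟨fun p => (p.1, p.2), by fun_prop⟩

/-- The retraction onto the closed slab. -/
def slabProj : C(Space, ClosedSlab) :=
  ⟨fun x => (projIcc (-1) 0 (by norm_num) x.1, x.2),
    ((continuous_projIcc (h := by norm_num)).comp continuous_fst).prodMk continuous_snd⟩

theorem slabIncl_slabProj {x : Space} (hx : x ∈ Omega) : slabIncl (slabProj x) = x := by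
  refine Prod.ext ?_ (by rfl)
  exact congrArg Subtype.val (projIcc_of_mem (by norm_num) (Ioo_subset_Icc_self hx.1))

/-- A smooth function, restricted to the closed slab. -/
def Smooth.restrict : Smooth →ₗ[ℝ] C(ClosedSlab, ℝ) where
  toFun f := ⟨fun p => f.1 (slabIncl p), (isSmooth f).continuous.comp slabIncl.continuous⟩
  map_add' _ _ := rfl
  map_smul' _ _ := rfl

theorem Smooth.restrict_apply (f : Smooth) (p : ClosedSlab) :
    Smooth.restrict f p = f.1 (slabIncl p) := rfl

/-- The restrictions to the closed slab of the linear combinations of the modes with phase `α`. -/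
def modeSpan (α : ℝ) : Submodule ℝ C(ClosedSlab, ℝ) :=
  Submodule.span ℝ {f | ∃ n k c, f = Smooth.restrict (mode α n k c)}

theorem restrict_mode_mem_modeSpan (α : ℝ) (n : ℤ) (k : Fin 2 → ℤ) (c : ℂ) :
    Smooth.restrict (mode α n k c) ∈ modeSpan α :=
  Submodule.subset_span ⟨n, k, c, rfl⟩

/-- The continuous functions that multiply the span of the modes into itself. -/
def multiplierAlgebra (α : ℝ) : Subalgebra ℝ C(ClosedSlab, ℝ) where
  carrier := {g | ∀ f ∈ modeSpan α, g * f ∈ modeSpan α}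
  mul_mem' {g h} hg hh f hf := by
    rw [mul_assoc]
    exact hg _ (hh f hf)
  add_mem' {g h} hg hh f hf := by
    rw [add_mul]
    exact add_mem (hg f hf) (hh f hf)
  algebraMap_mem' r f hf := by
    rw [← Algebra.smul_def]
    exact Submodule.smul_mem _ r hf

/-- It suffices to test a multiplier on the modes themselves. -/
theorem mem_multiplierAlgebra {α : ℝ} {g : C(ClosedSlab, ℝ)}
    (h : ∀ n k c, g * Smooth.restrict (mode α n k c) ∈ modeSpan α) : g ∈ multiplierAlgebra α := by
  intro f hf
  induction hf using Submodule.span_induction with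
  | mem f hf =>
    obtain ⟨n, k, c, rfl⟩ := hf
    exact h n k c
  | zero => rw [mul_zero]; exact zero_mem _
  | add f f' _ _ hf hf' => rw [mul_add]; exact add_mem hf hf'
  | smul r f _ hf => rw [mul_smul_comm]; exact Submodule.smul_mem _ r hf

theorem normal_wave_mem_multiplierAlgebra (α : ℝ) :
    (⟨fun p => Real.cos (Real.pi * (p.1 + 1)), by fun_prop⟩ : C(ClosedSlab, ℝ)) ∈
      multiplierAlgebra α := by
  refine mem_multiplierAlgebra fun n k c => ?_
  have e : (⟨fun p => Real.cos (Real.pi * (p.1 + 1)), by fun_prop⟩ : C(ClosedSlab, ℝ)) *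
      Smooth.restrict (mode α n k c) = (1 / 2 : ℝ) • Smooth.restrict (mode α (n + 1) k c) +
        (1 / 2 : ℝ) • Smooth.restrict (mode α (n - 1) k c) := by
    ext p
    simp only [ContinuousMap.mul_apply, ContinuousMap.coe_mk, ContinuousMap.add_apply,
      ContinuousMap.smul_apply, Smooth.restrict_apply, mode_apply, slabIncl, smul_eq_mul]
    have h1 : ((n + 1 : ℤ) + 1 / 2 : ℝ) * Real.pi * (p.1 + 1) - α =
      ((n + 1 / 2 : ℝ) * Real.pi * (p.1 + 1) - α) + Real.pi * (p.1 + 1) := by push_cast; ring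
    have h2 : ((n - 1 : ℤ) + 1 / 2 : ℝ) * Real.pi * (p.1 + 1) - α =
      ((n + 1 / 2 : ℝ) * Real.pi * (p.1 + 1) - α) - Real.pi * (p.1 + 1) := by push_cast; ring
    rw [h1, h2, Real.cos_add _ (Real.pi * (p.1 + 1)), Real.cos_sub _ (Real.pi * (p.1 + 1))]
    ring
  rw [e]
  exact add_mem (Submodule.smul_mem _ _ (restrict_mode_mem_modeSpan _ _ _ _))
    (Submodule.smul_mem _ _ (restrict_mode_mem_modeSpan _ _ _ _))

theorem tangential_wave_mem_multiplierAlgebra (α : ℝ) (l : Fin 2 → ℤ) (d : ℂ) :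
    (⟨fun p => (d * UnitAddTorus.mFourier l p.2).re, by fun_prop⟩ : C(ClosedSlab, ℝ)) ∈
      multiplierAlgebra α := by
  refine mem_multiplierAlgebra fun n k c => ?_
  have e : (⟨fun p => (d * UnitAddTorus.mFourier l p.2).re, by fun_prop⟩ : C(ClosedSlab, ℝ)) *
      Smooth.restrict (mode α n k c) =
        (1 / 2 : ℝ) • Smooth.restrict (mode α n (l + k) (d * c)) +
        (1 / 2 : ℝ) • Smooth.restrict (mode α n (l + -k) (d * (starRingEnd ℂ) c)) := by
    ext p
    change (d * UnitAddTorus.mFourier l p.2).re * (mode α n k c).1 (slabIncl p) =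
      1 / 2 * (mode α n (l + k) (d * c)).1 (slabIncl p) +
      1 / 2 * (mode α n (l + -k) (d * (starRingEnd ℂ) c)).1 (slabIncl p)
    simp only [mode_apply, slabIncl, ContinuousMap.coe_mk, UnitAddTorus.mFourier_add,
      UnitAddTorus.mFourier_neg, Complex.mul_re, Complex.mul_im, Complex.conj_re, Complex.conj_im]
    ring
  rw [e]
  exact add_mem (Submodule.smul_mem _ _ (restrict_mode_mem_modeSpan _ _ _ _))
    (Submodule.smul_mem _ _ (restrict_mode_mem_modeSpan _ _ _ _))

theorem multiplierAlgebra_separatesPoints (α : ℝ) : (multiplierAlgebra α).SeparatesPoints := by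
  intro p q hpq
  by_cases h : p.2 = q.2
  · refine ⟨_, ⟨_, normal_wave_mem_multiplierAlgebra α, rfl⟩, fun he => hpq (Prod.ext ?_ h)⟩
    have hm : ∀ r : Icc (-1 : ℝ) 0, Real.pi * (r + 1) ∈ Icc 0 Real.pi := fun r =>
      ⟨mul_nonneg Real.pi_pos.le (by linarith [r.2.1]),
        mul_le_of_le_one_right Real.pi_pos.le (by linarith [r.2.2])⟩
    have := mul_left_cancel₀ Real.pi_ne_zero (Real.injOn_cos (hm p.1) (hm q.1) he)
    exact Subtype.ext (by linarith)
  · obtain ⟨j, hj⟩ := not_forall.1 fun h' => h (funext h')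
    by_contra! hs
    have h1 := hs _ ⟨_, tangential_wave_mem_multiplierAlgebra α (Pi.single j 1) 1, rfl⟩
    have h2 := hs _ ⟨_, tangential_wave_mem_multiplierAlgebra α (Pi.single j 1) (-Complex.I), rfl⟩
    simp only [ContinuousMap.coe_mk, UnitAddTorus.mFourier_single] at h1 h2
    refine hj (AddCircle.injective_toCircle one_ne_zero (Subtype.ext ?_))
    rw [← fourier_one, ← fourier_one]
    exact Complex.ext (by simpa using h1) (by simpa using h2)

/-- The restriction to `Ω⁻` of a continuous function on the closed slab, as an element of `L²`. -/
def contToL2 : C(ClosedSlab, ℝ) →L[ℝ] L2 :=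
  LinearMap.mkContinuous
    { toFun := fun g => (memLp_slab (g.continuous.comp slabProj.continuous) 2).toLp (g ∘ slabProj)
      map_add' := fun g h => MemLp.toLp_add
        (memLp_slab (g.continuous.comp slabProj.continuous) 2)
        (memLp_slab (h.continuous.comp slabProj.continuous) 2)
      map_smul' := fun c g => MemLp.toLp_const_smul c
        (memLp_slab (g.continuous.comp slabProj.continuous) 2) }
    (measureUnivNNReal slabMeasure ^ (2 : ℝ≥0∞).toReal⁻¹) fun g => by
      refine Lp.norm_le_of_ae_bound (norm_nonneg g) ?_
      filter_upwards [MemLp.coeFn_toLp (memLp_slab (g.continuous.comp slabProj.continuous) 2)]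
        with x hx
      exact (congrArg norm hx).le.trans (g.norm_coe_le_norm _)

theorem coeFn_contToL2 (g : C(ClosedSlab, ℝ)) :
    contToL2 g =ᵐ[slabMeasure] fun x => g (slabProj x) :=
  MemLp.coeFn_toLp (memLp_slab (g.continuous.comp slabProj.continuous) 2)

theorem contToL2_restrict (f : Smooth) : contToL2 (Smooth.restrict f) = toL2 f := by
  ext1
  filter_upwards [coeFn_contToL2 (Smooth.restrict f), coeFn_toL2 f, ae_mem_Omega] with x h1 h2 h3
  rw [h1, h2, Smooth.restrict_apply, slabIncl_slabProj h3]

/-- Completeness of the modes. If `u` is orthogonal to them, then `u` times the lowest mode is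
orthogonal to the multiplier algebra, which is uniformly dense by the Stone–Weierstrass theorem; and
the lowest mode has no zeros. -/
theorem eq_zero_of_inner_mode {α : ℝ}
    (hα : ∀ t ∈ Ioo (-1 : ℝ) 0, Real.cos (1 / 2 * Real.pi * (t + 1) - α) ≠ 0) {u : L2}
    (hu : ∀ n k c, inner ℝ u (toL2 (mode α n k c)) = 0) : u = 0 := by
  set m : Smooth := mode α 0 0 1 with hm
  have hmx : ∀ x, m.1 x = Real.cos (1 / 2 * Real.pi * (x.1 + 1) - α) := by
    intro x
    simp [hm, mode_apply, UnitAddTorus.mFourier_zero]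
  have h1 : ∀ f ∈ modeSpan α, inner ℝ u (contToL2 f) = 0 := by
    intro f hf
    induction hf using Submodule.span_induction with
    | mem f hf =>
      obtain ⟨n, k, c, rfl⟩ := hf
      rw [contToL2_restrict, hu]
    | zero => rw [map_zero, inner_zero_right]
    | add f g _ _ hf hg => rw [map_add, inner_add_right, hf, hg, add_zero]
    | smul r f _ hf => rw [map_smul, inner_smul_right, hf, mul_zero]
  have h2 : ∀ g : C(ClosedSlab, ℝ), inner ℝ u (contToL2 (g * Smooth.restrict m)) = 0 := by
    intro g
    have hg : g ∈ (multiplierAlgebra α).topologicalClosure := by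
      rw [ContinuousMap.subalgebra_topologicalClosure_eq_top_of_separatesPoints _
        (multiplierAlgebra_separatesPoints α)]
      trivial
    have hcl : IsClosed {g : C(ClosedSlab, ℝ) |
        inner ℝ u (contToL2 (g * Smooth.restrict m)) = 0} :=
      isClosed_eq (by fun_prop) continuous_const
    refine closure_minimal (fun g hg => ?_) hcl hg
    exact h1 _ (hg _ (restrict_mode_mem_modeSpan _ _ _ _))
  have hw : MemLp (fun x => m.1 x * u x) 2 slabMeasure := by
    obtain ⟨C, hC⟩ := exists_bound_Omega (isSmooth m).continuous
    refine (Lp.memLp u).of_le_mul (c := C)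
      (((isSmooth m).aestronglyMeasurable _).mul (Lp.aestronglyMeasurable u)) ?_
    filter_upwards [ae_mem_Omega] with x hx
    rw [norm_mul]
    exact mul_le_mul_of_nonneg_right (hC x hx) (norm_nonneg _)
  have hw0 : hw.toLp _ = 0 := by
    refine (BoundedContinuousFunction.toLp_denseRange ℝ slabMeasure ℝ
      (p := 2) (by norm_num)).eq_zero_of_inner_left ℝ fun g => ?_
    rw [← h2 (g.toContinuousMap.comp slabIncl), L2.inner_def, L2.inner_def]
    refine integral_congr_ae ?_
    filter_upwards [hw.coeFn_toLp, BoundedContinuousFunction.coeFn_toLp (p := 2) slabMeasure ℝ g,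
      coeFn_contToL2 (g.toContinuousMap.comp slabIncl * Smooth.restrict m), ae_mem_Omega]
      with x e1 e2 e3 hx
    rw [e1, e2, e3, ContinuousMap.mul_apply, ContinuousMap.comp_apply, Smooth.restrict_apply,
      slabIncl_slabProj hx]
    simp only [RCLike.inner_apply, conj_trivial, BoundedContinuousFunction.coe_toContinuousMap]
    ring
  ext1
  filter_upwards [hw.coeFn_toLp, ae_mem_Omega, (Lp.eq_zero_iff_ae_eq_zero.1 hw0),
    Lp.coeFn_zero ℝ 2 slabMeasure] with x e1 hx e2 e3
  rw [e2, hmx] at e1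
  rw [e3]
  exact (mul_eq_zero.1 e1.symm).resolve_left (hα _ hx.1)

theorem exists_phase {ε : ℝ} (hε : ε = 1 ∨ ε = -1) : ∃ α : ℝ,
    (∀ x, Real.cos (x + α) = -(ε * Real.cos (x - α))) ∧
    ∀ t ∈ Ioo (-1 : ℝ) 0, Real.cos (1 / 2 * Real.pi * (t + 1) - α) ≠ 0 := by
  have hpi := Real.pi_pos
  rcases hε with rfl | rfl
  · refine ⟨Real.pi / 2, fun x => ?_, fun t ht => ne_of_gt ?_⟩
    · rw [Real.cos_add_pi_div_two, Real.cos_sub_pi_div_two, one_mul]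
    · exact Real.cos_pos_of_mem_Ioo ⟨by nlinarith [ht.1], by nlinarith [ht.2]⟩
  · refine ⟨0, fun x => by simp, fun t ht => ne_of_gt ?_⟩
    exact Real.cos_pos_of_mem_Ioo ⟨by nlinarith [ht.1], by nlinarith [ht.2]⟩

/-- The Laplacians of the smooth functions of a given parity are dense in `L²`. -/
theorem eq_zero_of_inner_lap {ε : ℝ} (hε : ε = 1 ∨ ε = -1) {u : L2}
    (hu : ∀ f ∈ parity ε, inner ℝ u (toL2 (lap f)) = 0) : u = 0 := by
  obtain ⟨α, h1, h2⟩ := exists_phase hε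
  refine eq_zero_of_inner_mode h2 fun n k c => ?_
  have h := hu _ (mode_mem_parity h1 n k c)
  rw [lap_mode, map_smul, inner_smul_right] at h
  exact (mul_eq_zero.1 h).resolve_left (lap_mode_coeff_ne_zero n _ _)

theorem eq_zero_of_inner_parity {ε : ℝ} (hε : ε = 1 ∨ ε = -1) {u : L2}
    (hu : ∀ f ∈ parity ε, inner ℝ u (toL2 f) = 0) : u = 0 :=
  eq_zero_of_inner_lap hε fun _ hf => hu _ (lap_mem_parity hf)

/-! ### Vector calculus -/

theorem one_or_neg_one_neg {ε : ℝ} (hε : ε = 1 ∨ ε = -1) : -ε = 1 ∨ -ε = -1 := by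
  rcases hε with rfl | rfl <;> norm_num

/-- Integration by parts in the normal direction: for `ε = 1` the boundary terms vanish because of
`u` on `Γ₋` and because of `g` on `Γ`, for `ε = -1` the other way round. -/
theorem inner_partialD_zero {ε : ℝ} (hε : ε = 1 ∨ ε = -1) {u : H1}
    (hu : u ∈ vanishingOn (-(1 + ε) / 2)) {g : Smooth} (hg : g ∈ parity (-ε)) :
    inner ℝ (partialD 0 u) (toL2 g) = -inner ℝ (fn u) (toL2 (D 0 g)) := by
  rcases hε with rfl | rfl
  · exact inner_partialD_zero_of_mem_vanishingOn_neg_one (by norm_num at hu; exact hu)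
      (eq_zero_of_parity_neg_one hg)
  · exact inner_partialD_zero_of_mem_vanishingOn_zero (by norm_num at hu; exact hu)
      (eq_zero_of_parity_one (by simpa using hg))

theorem eq_zero_of_mem_parity {ε : ℝ} (hε : ε = 1 ∨ ε = -1) {f : Smooth} (hf : f ∈ parity ε)
    (y : UnitAddTorus (Fin 2)) : f.1 (-(1 + ε) / 2, y) = 0 := by
  rcases hε with rfl | rfl
  · norm_num
    exact eq_zero_of_parity_one hf y
  · norm_num
    exact eq_zero_of_parity_neg_one hf y

theorem toH1_mem_vanishingOn {ε : ℝ} (hε : ε = 1 ∨ ε = -1) {f : Smooth} (hf : f ∈ parity ε) :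
    toH1 f ∈ vanishingOn (-(1 + ε) / 2) :=
  mem_vanishingOn_toH1 (eq_zero_of_mem_parity hε hf)

theorem inner_eq_sum_comp (v w : L2Field) : inner ℝ v w = ∑ i, inner ℝ (comp i v) (comp i w) := by
  simp only [L2.inner_def]
  rw [← integral_finsetSum]
  · have h : ∀ (i : Fin 3) (u : L2Field), comp i u =ᵐ[slabMeasure] fun x => u x i := fun i u =>
      ContinuousLinearMap.coeFn_compLpL (p := 2) (μ := slabMeasure)
        (EuclideanSpace.proj i : EuclideanSpace ℝ (Fin 3) →L[ℝ] ℝ) u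
    refine integral_congr_ae ?_
    filter_upwards [eventually_all.2 fun i => h i v, eventually_all.2 fun i => h i w] with x h1 h2
    simp only [h1, h2, PiLp.inner_apply]
  · exact fun i _ => L2.integrable_inner _ _

theorem norm_sq_eq_sum_comp (v : L2Field) : ‖v‖ ^ 2 = ∑ i, ‖comp i v‖ ^ 2 := by
  simp only [← real_inner_self_eq_norm_sq]
  exact inner_eq_sum_comp v v

theorem field_ext {v w : L2Field} (h : ∀ i, comp i v = comp i w) : v = w := by
  rw [← sub_eq_zero, ← norm_eq_zero, ← sq_eq_zero_iff, norm_sq_eq_sum_comp]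
  simp [h]

theorem inner_field (v : L2Field) (w : Fin 3 → L2) :
    inner ℝ v (field w) = ∑ i, inner ℝ (comp i v) (w i) := by
  simp only [inner_eq_sum_comp, comp_field]

@[simp] theorem coord_apply (i : Fin 3) (η : H1Field) : coord i η = η i := rfl

theorem comp_curl_zero (η : H1Field) :
    comp 0 (curl η) = partialD 1 (η 2) - partialD 2 (η 1) := by
  simp [curl, comp_inComp]

theorem comp_curl_one (η : H1Field) :
    comp 1 (curl η) = partialD 2 (η 0) - partialD 0 (η 2) := by
  simp [curl, comp_inComp]

theorem comp_curl_two (η : H1Field) :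
    comp 2 (curl η) = partialD 0 (η 1) - partialD 1 (η 0) := by
  simp [curl, comp_inComp]

theorem div_apply (η : H1Field) : div η = ∑ i, partialD i (η i) := by
  simp [div]

theorem mem_tangential {η : H1Field} :
    η ∈ H1TangentialOnGamma ↔ η 1 ∈ vanishingOn 0 ∧ η 2 ∈ vanishingOn 0 := by
  have h0 : constCross normal 0 η = 0 := by simp [constCross, normal]
  have h1 : constCross normal 1 η = -η 2 := by simp [constCross, normal]
  have h2 : constCross normal 2 η = η 1 := by simp [constCross, normal]
  rw [H1TangentialOnGamma, Submodule.mem_iInf]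
  simp only [Submodule.mem_comap]
  refine ⟨fun h => ⟨h2 ▸ h 2, neg_mem_iff.1 (h1 ▸ h 1)⟩, fun h i => ?_⟩
  fin_cases i
  · exact h0 ▸ zero_mem _
  · exact h1 ▸ neg_mem h.2
  · exact h2 ▸ h.1

/-- The curl of a smooth vector field. -/
def smoothCurl (c : Fin 3 → Smooth) : Fin 3 → Smooth :=
  ![D 1 (c 2) - D 2 (c 1), D 2 (c 0) - D 0 (c 2), D 0 (c 1) - D 1 (c 0)]

/-- The divergence of a smooth vector field. -/
def smoothDiv : (Fin 3 → Smooth) →ₗ[ℝ] Smooth := ∑ i, D i ∘ₗ LinearMap.proj i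

theorem smoothDiv_apply (c : Fin 3 → Smooth) : smoothDiv c = ∑ i, D i (c i) := by
  simp [smoothDiv]

theorem smoothDiv_smoothCurl (c : Fin 3 → Smooth) : smoothDiv (smoothCurl c) = 0 := by
  simp only [smoothDiv_apply, Fin.sum_univ_three, smoothCurl, Matrix.cons_val, map_sub]
  rw [D_comm 1 0, D_comm 2 0, D_comm 2 1]
  abel

theorem smoothCurl_grad (g : Smooth) : smoothCurl (fun i => D i g) = 0 := by
  funext i
  fin_cases i <;> simp [smoothCurl, D_comm 1 0, D_comm 2 0, D_comm 2 1]

/-- `curl curl = ∇ div - Δ`. -/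
theorem smoothCurl_smoothCurl (c : Fin 3 → Smooth) (i : Fin 3) :
    smoothCurl (smoothCurl c) i = D i (smoothDiv c) - lap (c i) := by
  simp only [smoothDiv_apply, lap_apply, Fin.sum_univ_three, map_add]
  fin_cases i <;>
    simp only [smoothCurl, Fin.zero_eta, Fin.mk_one, Fin.reduceFinMk, Matrix.cons_val, map_sub,
      D_comm 1 0, D_comm 2 0, D_comm 2 1] <;> abel

/-- A smooth vector field as an element of `H¹(Ω⁻; ℝ³)`. -/
def toH1Field : (Fin 3 → Smooth) →ₗ[ℝ] H1Field where
  toFun c := WithLp.toLp 2 fun i => toH1 (c i)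
  map_add' c d := by ext1 i; simp
  map_smul' r c := by ext1 i; simp

@[simp] theorem toH1Field_apply (c : Fin 3 → Smooth) (i : Fin 3) :
    toH1Field c i = toH1 (c i) := rfl

theorem curl_toH1Field (c : Fin 3 → Smooth) :
    curl (toH1Field c) = field fun i => toL2 (smoothCurl c i) := by
  refine field_ext fun i => ?_
  rw [comp_field]
  fin_cases i
  · exact (comp_curl_zero _).trans (by simp [smoothCurl])
  · exact (comp_curl_one _).trans (by simp [smoothCurl])
  · exact (comp_curl_two _).trans (by simp [smoothCurl])

theorem grad_toH1 (g : Smooth) : grad (toH1 g) = field fun i => toL2 (D i g) := rfl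

theorem div_toH1Field (c : Fin 3 → Smooth) : div (toH1Field c) = toL2 (smoothDiv c) := by
  simp [div_apply, smoothDiv_apply]

/-- The curl is symmetric between fields tangentially zero on `Γ` and smooth fields tangentially
zero on `Γ₋`. -/
theorem inner_curl {η : H1Field} (hη : η ∈ H1TangentialOnGamma) {c : Fin 3 → Smooth}
    (h1 : c 1 ∈ parity 1) (h2 : c 2 ∈ parity 1) :
    inner ℝ (curl η) (field fun i => toL2 (c i)) =
      ∑ i, inner ℝ (fn (η i)) (toL2 (smoothCurl c i)) := by
  obtain ⟨ht1, ht2⟩ := mem_tangential.1 hη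
  have hz : ∀ {u : H1} {g : Smooth}, u ∈ vanishingOn 0 → g ∈ parity 1 →
      inner ℝ (partialD 0 u) (toL2 g) = -inner ℝ (fn u) (toL2 (D 0 g)) := fun hu hg =>
    inner_partialD_zero_of_mem_vanishingOn_zero hu (eq_zero_of_parity_one hg)
  have hs1 : ∀ (u : H1) (g : Smooth),
      inner ℝ (partialD 1 u) (toL2 g) = -inner ℝ (fn u) (toL2 (D 1 g)) := inner_partialD_succ 0
  have hs2 : ∀ (u : H1) (g : Smooth),
      inner ℝ (partialD 2 u) (toL2 g) = -inner ℝ (fn u) (toL2 (D 2 g)) := inner_partialD_succ 1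
  simp only [inner_field, Fin.sum_univ_three, comp_curl_zero, comp_curl_one, comp_curl_two,
    inner_sub_left, hs1, hs2, hz ht1 h2, hz ht2 h1, smoothCurl, Matrix.cons_val, map_sub,
    inner_sub_right]
  ring

theorem inner_grad {ε : ℝ} (hε : ε = 1 ∨ ε = -1) {u : H1} (hu : u ∈ vanishingOn (-(1 + ε) / 2))
    {c : Fin 3 → Smooth} (hc : c 0 ∈ parity (-ε)) :
    inner ℝ (grad u) (field fun i => toL2 (c i)) = -inner ℝ (fn u) (toL2 (smoothDiv c)) := by
  simp only [inner_field, smoothDiv_apply, map_sum, inner_sum, ← Finset.sum_neg_distrib]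
  refine Finset.sum_congr rfl fun i _ => ?_
  refine Fin.cases ?_ (fun j => ?_) i
  · exact inner_partialD_zero hε hu hc
  · exact inner_partialD_succ j u _

theorem inner_grad_grad {ε : ℝ} (hε : ε = 1 ∨ ε = -1) {u : H1}
    (hu : u ∈ vanishingOn (-(1 + ε) / 2)) {g : Smooth} (hg : g ∈ parity ε) :
    inner ℝ (grad u) (grad (toH1 g)) = -inner ℝ (fn u) (toL2 (lap g)) := by
  rw [grad_toH1, inner_grad hε hu (c := fun i => D i g) (D_zero_mem_parity rfl hg),
    smoothDiv_apply, lap_apply]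

/-- Curls of fields tangentially zero on `Γ` are orthogonal to gradients of smooth functions with
the parity that makes them vanish on `Γ₋`. -/
theorem inner_curl_grad_toH1 {η : H1Field} (hη : η ∈ H1TangentialOnGamma) {g : Smooth}
    (hg : g ∈ parity 1) : inner ℝ (curl η) (grad (toH1 g)) = 0 := by
  rw [grad_toH1, inner_curl hη (c := fun i => D i g) (D_succ_mem_parity 0 hg)
    (D_succ_mem_parity 1 hg), smoothCurl_grad]
  simp

/-- The parities of the components of the potential `η`: it is `ε = 1` for `η₁` and `ε = -1` for
`η₂`, `η₃`. -/
def fieldSign : Fin 3 → ℝ := ![1, -1, -1]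

theorem fieldSign_eq (i : Fin 3) : fieldSign i = 1 ∨ fieldSign i = -1 := by
  fin_cases i <;> simp [fieldSign]

/-- The smooth vector fields with components of parity `δ`, `-δ`, `-δ`. -/
def fieldParity (δ : ℝ) : Submodule ℝ (Fin 3 → Smooth) :=
  Submodule.pi univ fun i => parity (δ * fieldSign i)

theorem mem_fieldParity {δ : ℝ} {c : Fin 3 → Smooth} :
    c ∈ fieldParity δ ↔ c 0 ∈ parity δ ∧ c 1 ∈ parity (-δ) ∧ c 2 ∈ parity (-δ) := by
  simp [fieldParity, Submodule.mem_pi, Fin.forall_fin_succ, fieldSign]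

theorem smoothCurl_mem_fieldParity {δ : ℝ} {c : Fin 3 → Smooth} (hc : c ∈ fieldParity δ) :
    smoothCurl c ∈ fieldParity (-δ) := by
  obtain ⟨h0, h1, h2⟩ := mem_fieldParity.1 hc
  have e : δ = -(-δ) := (neg_neg δ).symm
  refine mem_fieldParity.2 ⟨?_, ?_, ?_⟩
  · exact sub_mem (D_succ_mem_parity 0 h2) (D_succ_mem_parity 1 h1)
  · rw [← e]
    exact sub_mem (D_succ_mem_parity 1 h0) (D_zero_mem_parity e h2)
  · rw [← e]
    exact sub_mem (D_zero_mem_parity e h1) (D_succ_mem_parity 0 h0)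

theorem smoothDiv_mem_parity {δ : ℝ} {c : Fin 3 → Smooth} (hc : c ∈ fieldParity δ) :
    smoothDiv c ∈ parity (-δ) := by
  obtain ⟨h0, h1, h2⟩ := mem_fieldParity.1 hc
  rw [smoothDiv_apply, Fin.sum_univ_three]
  exact add_mem (add_mem (D_zero_mem_parity rfl h0) (D_succ_mem_parity 0 h1))
    (D_succ_mem_parity 1 h2)

theorem single_mem_fieldParity {δ : ℝ} {i : Fin 3} {f : Smooth}
    (hf : f ∈ parity (δ * fieldSign i)) : Pi.single i f ∈ fieldParity δ := by
  refine Submodule.mem_pi.2 fun j _ => ?_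
  by_cases h : j = i
  · subst h
    simpa using hf
  · simp [h]

/-- The boundary conditions for the potential `η`, component by component. -/
theorem mem_vanishingOn_fieldSign {η : H1Field} (hη : η ∈ H1TangentialOnGamma)
    (h0 : coord 0 η ∈ vanishingOn (-1)) (i : Fin 3) :
    η i ∈ vanishingOn (-(1 + fieldSign i) / 2) := by
  obtain ⟨h1, h2⟩ := mem_tangential.1 hη
  fin_cases i
  · norm_num [fieldSign]
    exact h0
  · norm_num [fieldSign]
    exact h1
  · norm_num [fieldSign]
    exact h2

theorem inner_div {η : H1Field}
    (h0 : coord 0 η ∈ vanishingOn (-1)) {d : Smooth} (hd : d ∈ parity (-1)) :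
    inner ℝ (div η) (toL2 d) = -∑ i, inner ℝ (fn (η i)) (toL2 (D i d)) := by
  rw [div_apply, sum_inner, ← Finset.sum_neg_distrib]
  refine Finset.sum_congr rfl fun i _ => ?_
  refine Fin.cases ?_ (fun j => ?_) i
  · exact inner_partialD_zero_of_mem_vanishingOn_neg_one h0 (eq_zero_of_parity_neg_one hd)
  · exact inner_partialD_succ j _ _

/-- The weak form of `curl curl - ∇ div = -Δ`. -/
theorem inner_curl_add_inner_div {η : H1Field} (hη : η ∈ H1TangentialOnGamma)
    (h0 : coord 0 η ∈ vanishingOn (-1)) {c : Fin 3 → Smooth} (hc : c ∈ fieldParity 1) :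
    inner ℝ (curl η) (curl (toH1Field c)) + inner ℝ (div η) (div (toH1Field c)) =
      -∑ i, inner ℝ (fn (η i)) (toL2 (lap (c i))) := by
  obtain ⟨-, h1, h2⟩ := mem_fieldParity.1 (smoothCurl_mem_fieldParity hc)
  rw [neg_neg] at h1 h2
  rw [curl_toH1Field, div_toH1Field, inner_curl hη h1 h2,
    inner_div h0 (smoothDiv_mem_parity hc), ← sub_eq_add_neg, ← Finset.sum_sub_distrib,
    ← Finset.sum_neg_distrib]
  refine Finset.sum_congr rfl fun i _ => ?_
  rw [smoothCurl_smoothCurl, map_sub, inner_sub_right]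
  ring

/-! ### A priori estimates for smooth potentials -/

theorem toH1Field_mem_tangential {c : Fin 3 → Smooth} (hc : c ∈ fieldParity 1) :
    toH1Field c ∈ H1TangentialOnGamma := by
  obtain ⟨-, h1, h2⟩ := mem_fieldParity.1 hc
  exact mem_tangential.2 ⟨mem_vanishingOn_toH1 (eq_zero_of_parity_neg_one h1),
    mem_vanishingOn_toH1 (eq_zero_of_parity_neg_one h2)⟩

theorem coord_toH1Field_mem_vanishingOn {c : Fin 3 → Smooth} (hc : c ∈ fieldParity 1) :
    coord 0 (toH1Field c) ∈ vanishingOn (-1) :=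
  mem_vanishingOn_toH1 (eq_zero_of_parity_one (mem_fieldParity.1 hc).1)

/-- Gaffney's identity: in a flat domain there is no curvature term on the boundary. -/
theorem sum_norm_sq_grad {c : Fin 3 → Smooth} (hc : c ∈ fieldParity 1) :
    ∑ i, ‖grad (toH1 (c i))‖ ^ 2 = ‖curl (toH1Field c)‖ ^ 2 + ‖div (toH1Field c)‖ ^ 2 := by
  have h := inner_curl_add_inner_div (toH1Field_mem_tangential hc)
    (coord_toH1Field_mem_vanishingOn hc) hc
  rw [real_inner_self_eq_norm_sq, real_inner_self_eq_norm_sq] at h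
  rw [h, ← Finset.sum_neg_distrib]
  refine Finset.sum_congr rfl fun i _ => ?_
  have hi : c i ∈ parity (fieldSign i) := by
    simpa using Submodule.mem_pi.1 hc i (mem_univ i)
  rw [← real_inner_self_eq_norm_sq, inner_grad_grad (fieldSign_eq i)
    (toH1_mem_vanishingOn (fieldSign_eq i) hi) hi]
  rfl

/-- Poincaré's inequality. The multiplier is `x₁ - b`, where `x₁ = b` is the boundary component on
which `f` need not vanish: integrating `∂₁((x₁ - b) f²)` gives no boundary terms. -/
theorem norm_toL2_le {ε : ℝ} (hε : ε = 1 ∨ ε = -1) {f : Smooth} (hf : f ∈ parity ε) :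
    ‖toL2 f‖ ≤ 2 * ‖toL2 (D 0 f)‖ := by
  obtain ⟨b, hb, hfb⟩ : ∃ b : ℝ, b ∈ Icc (-1 : ℝ) 0 ∧ ∀ t : ℝ, t = 0 ∨ t = -1 → ∀ y,
      f.1 (t, y) * (f.1 (t, y) * (t - b)) = 0 := by
    rcases hε with rfl | rfl
    · refine ⟨0, by norm_num, ?_⟩
      rintro t (rfl | rfl) y
      · simp
      · simp [eq_zero_of_parity_one hf y]
    · refine ⟨-1, by norm_num, ?_⟩
      rintro t (rfl | rfl) y
      · simp [eq_zero_of_parity_neg_one hf y]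
      · simp
  have hm : IsSmooth fun x => x.1 - b :=
    isSmooth_comp_fst (χ := fun t => t - b) (by fun_prop)
  let m : Smooth := ⟨fun x => x.1 - b, hm⟩
  let fm : Smooth := ⟨f.1 * m.1, (isSmooth f).mul hm⟩
  let dfm : Smooth := ⟨(D 0 f).1 * m.1, (isSmooth (D 0 f)).mul hm⟩
  have e1 : D 0 fm = dfm + f := by
    refine Subtype.ext (((isSmooth f).pderiv_mul hm 0).trans ?_)
    refine congrArg₂ (· + ·) rfl (funext fun x => ?_)
    have : pderiv 0 (fun x : Space => x.1 - b) x = 1 := by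
      refine (pderiv_zero_comp_fst (fun t => t - b) x).trans ?_
      simp
    simp [this]
  have e2 : inner ℝ (toL2 f) (toL2 dfm) = inner ℝ (toL2 (D 0 f)) (toL2 fm) := by
    rw [inner_toL2_toL2, inner_toL2_toL2]
    congr 1
    funext x
    simp only [dfm, fm, Pi.mul_apply]
    ring
  have h := inner_D_zero_add f fm
  rw [e1, map_add, inner_add_right, e2, real_inner_self_eq_norm_sq] at h
  have hz : ∀ t : ℝ, t = 0 ∨ t = -1 → ∫ y, f.1 (t, y) * fm.1 (t, y) ∂torusMeasure = 0 :=
    fun t ht => (integral_congr_ae (Eventually.of_forall fun y => hfb t ht y)).trans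
      (integral_zero _ _)
  rw [hz 0 (Or.inl rfl), hz (-1) (Or.inr rfl), sub_zero] at h
  have hle : ‖toL2 fm‖ ≤ ‖toL2 f‖ := by
    refine Lp.norm_le_norm_of_ae_le ?_
    filter_upwards [coeFn_toL2 fm, coeFn_toL2 f, ae_mem_Omega] with x h1 h2 hx
    rw [h1, h2]
    change ‖f.1 x * (x.1 - b)‖ ≤ _
    rw [norm_mul]
    refine mul_le_of_le_one_right (norm_nonneg _) (abs_le.2 ⟨?_, ?_⟩)
    · linarith [hx.1.1, hb.2]
    · linarith [hx.1.2, hb.1]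
  have hcs := (abs_le.1 (abs_real_inner_le_norm (toL2 (D 0 f)) (toL2 fm))).1
  have h3 : ‖toL2 (D 0 f)‖ * ‖toL2 fm‖ ≤ ‖toL2 (D 0 f)‖ * ‖toL2 f‖ := by gcongr
  rcases (norm_nonneg (toL2 f)).eq_or_lt with h0 | h0
  · rw [← h0]
    positivity
  · refine le_of_mul_le_mul_right ?_ h0
    nlinarith

theorem norm_sq_H1 (u : H1) : ‖u‖ ^ 2 = ‖fn u‖ ^ 2 + ‖grad u‖ ^ 2 :=
  WithLp.prod_norm_sq_eq_of_L2 u.1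

theorem norm_sq_toH1_le {ε : ℝ} (hε : ε = 1 ∨ ε = -1) {f : Smooth} (hf : f ∈ parity ε) :
    ‖toH1 f‖ ^ 2 ≤ 5 * ‖grad (toH1 f)‖ ^ 2 := by
  have h1 : ‖toL2 f‖ ^ 2 ≤ (2 * ‖toL2 (D 0 f)‖) ^ 2 :=
    pow_le_pow_left₀ (norm_nonneg _) (norm_toL2_le hε hf) 2
  have h2 : ‖toL2 (D 0 f)‖ ^ 2 ≤ ‖grad (toH1 f)‖ ^ 2 := by
    rw [norm_sq_eq_sum_comp, ← partialD_toH1]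
    exact Finset.single_le_sum (f := fun i => ‖comp i (grad (toH1 f))‖ ^ 2)
      (fun i _ => sq_nonneg _) (Finset.mem_univ 0)
  rw [norm_sq_H1, fn_toH1]
  linarith

/-- The pairs `(η, φ)` of smooth potentials with a parity that entails the boundary conditions. -/
def smoothPotentials : Submodule ℝ ((Fin 3 → Smooth) × Smooth) :=
  (fieldParity 1 ⊓ LinearMap.ker smoothDiv).prod (parity 1)

/-- The a priori estimate: combine Gaffney's identity, Poincaré's inequality and the orthogonality
of `∇ × η` and `∇φ`. -/
theorem norm_sq_add_norm_sq_le {p : (Fin 3 → Smooth) × Smooth} (hp : p ∈ smoothPotentials) :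
    ‖toH1Field p.1‖ ^ 2 + ‖toH1 p.2‖ ^ 2 ≤
      5 * ‖curl (toH1Field p.1) + grad (toH1 p.2)‖ ^ 2 := by
  obtain ⟨⟨hc, hdiv⟩, hg⟩ := hp
  have h1 : ‖toH1Field p.1‖ ^ 2 ≤ 5 * ‖curl (toH1Field p.1)‖ ^ 2 := by
    have h := sum_norm_sq_grad hc
    rw [div_toH1Field, LinearMap.mem_ker.1 hdiv, map_zero, norm_zero, zero_pow two_ne_zero,
      add_zero] at h
    rw [← h, PiLp.norm_sq_eq_of_L2, Finset.mul_sum]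
    refine Finset.sum_le_sum fun i _ => norm_sq_toH1_le (fieldSign_eq i) ?_
    simpa using Submodule.mem_pi.1 hc i (mem_univ i)
  have h2 := norm_sq_toH1_le (Or.inl rfl) hg
  have h3 : ‖curl (toH1Field p.1) + grad (toH1 p.2)‖ ^ 2 =
      ‖curl (toH1Field p.1)‖ ^ 2 + ‖grad (toH1 p.2)‖ ^ 2 := by
    rw [norm_add_sq_real, inner_curl_grad_toH1 (toH1Field_mem_tangential hc) hg]
    ring
  rw [h3]
  linarith

/-! ### Density of the smooth potentials -/

/-- The map `(η, φ) ↦ ∇ × η + ∇φ` on pairs of smooth potentials. -/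
def potentialSum : (Fin 3 → Smooth) × Smooth →ₗ[ℝ] L2Field :=
  (curl ∘ₗ toH1Field).coprod (grad ∘ₗ toH1)

theorem potentialSum_apply (p : (Fin 3 → Smooth) × Smooth) :
    potentialSum p = curl (toH1Field p.1) + grad (toH1 p.2) := rfl

/-- Since `-Δ = curl curl - ∇ div`, the Laplacian of a smooth field of the right parity has explicit
smooth potentials. -/
theorem potentialSum_laplacian (w : Fin 3 → Smooth) :
    potentialSum (smoothCurl w, -smoothDiv w) = field fun i => -toL2 (lap (w i)) := by
  refine field_ext fun i => ?_
  rw [potentialSum_apply, map_add, comp_field, curl_toH1Field, comp_field, grad_toH1, comp_field,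
    smoothCurl_smoothCurl, map_neg, map_neg, map_sub]
  abel

theorem mem_smoothPotentials_laplacian {w : Fin 3 → Smooth} (hw : w ∈ fieldParity (-1)) :
    (smoothCurl w, -smoothDiv w) ∈ smoothPotentials := by
  refine ⟨⟨?_, smoothDiv_smoothCurl w⟩, neg_mem ?_⟩
  · simpa using smoothCurl_mem_fieldParity hw
  · simpa using smoothDiv_mem_parity hw

theorem topologicalClosure_map_smoothPotentials :
    (smoothPotentials.map potentialSum).topologicalClosure = ⊤ := by
  rw [Submodule.topologicalClosure_eq_top_iff, Submodule.eq_bot_iff]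
  intro v hv
  refine field_ext fun i => ?_
  rw [map_zero]
  have hε : -1 * fieldSign i = 1 ∨ -1 * fieldSign i = -1 := by
    rw [neg_one_mul]
    exact one_or_neg_one_neg (fieldSign_eq i)
  refine eq_zero_of_inner_lap hε fun f hf => ?_
  have h := (Submodule.mem_orthogonal' _ _).1 hv _ ⟨_, mem_smoothPotentials_laplacian
    (single_mem_fieldParity hf), rfl⟩
  rw [potentialSum_laplacian, inner_field, Finset.sum_eq_single i] at h
  · simpa using h
  · intro j _ hj
    simp [hj]
  · simp

/-! ### Completeness of `H¹` and existence of potentials -/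

theorem continuous_fn : Continuous fn := by
  have h : Continuous fun u : H1 => (WithLp.ofLp u.1).1 :=
    continuous_fst.comp ((WithLp.prod_continuous_ofLp 2 _ _).comp continuous_subtype_val)
  exact h

theorem continuous_grad : Continuous grad := by
  have h : Continuous fun u : H1 => (WithLp.ofLp u.1).2 :=
    continuous_snd.comp ((WithLp.prod_continuous_ofLp 2 _ _).comp continuous_subtype_val)
  exact h

theorem continuous_partialD (i : Fin 3) : Continuous (partialD i) :=
  (comp i).continuous.comp continuous_grad

theorem continuous_coord (i : Fin 3) : Continuous (coord i) :=
  PiLp.continuous_apply 2 (fun _ : Fin 3 => H1) i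

theorem continuous_curl : Continuous curl := by
  have h : ∀ i j k, Continuous fun η : H1Field => inComp i (partialD j (coord k η)) := fun i j k =>
    (inComp i).continuous.comp ((continuous_partialD j).comp (continuous_coord k))
  have : ⇑curl = fun η : H1Field =>
      (inComp 0 (partialD 1 (coord 2 η)) - inComp 0 (partialD 2 (coord 1 η))) +
      (inComp 1 (partialD 2 (coord 0 η)) - inComp 1 (partialD 0 (coord 2 η))) +
      (inComp 2 (partialD 0 (coord 1 η)) - inComp 2 (partialD 1 (coord 0 η))) := by
    funext η
    simp [curl]
  rw [this]
  exact (((h _ _ _).sub (h _ _ _)).add ((h _ _ _).sub (h _ _ _))).add ((h _ _ _).sub (h _ _ _))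

theorem continuous_div : Continuous div := by
  have : ⇑div = fun η : H1Field => ∑ i, partialD i (coord i η) := by
    funext η
    simp [div]
  rw [this]
  exact continuous_finsetSum _ fun i _ => (continuous_partialD i).comp (continuous_coord i)

theorem isClosed_H1 : IsClosed (H1 : Set (WithLp 2 (L2 × L2Field))) := by
  have h : (H1 : Set (WithLp 2 (L2 × L2Field))) = ⋂ (g : Smooth) (_ : IsTest g.1) (i : Fin 3),
      {p | inner ℝ p.fst (toL2 (D i g)) = -inner ℝ (comp i p.snd) (toL2 g)} := by
    ext p
    simp only [mem_iInter, mem_ofPred_eq, inner_toL2]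
    exact ⟨fun hp g hg i => hp g.1 hg i, fun hp ψ hψ i => hp ⟨ψ, hψ.1⟩ hψ i⟩
  rw [h]
  refine isClosed_iInter fun g => isClosed_iInter fun _ => isClosed_iInter fun i => ?_
  have h1 : Continuous fun p : WithLp 2 (L2 × L2Field) => p.fst :=
    continuous_fst.comp (WithLp.prod_continuous_ofLp 2 _ _)
  have h2 : Continuous fun p : WithLp 2 (L2 × L2Field) => p.snd :=
    continuous_snd.comp (WithLp.prod_continuous_ofLp 2 _ _)
  exact isClosed_eq (h1.inner continuous_const)
    (((comp i).continuous.comp h2).inner continuous_const).neg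

instance : CompleteSpace H1 := isClosed_H1.completeSpace_coe

/-- The functions `f n` themselves serve as the approximations that the definition of the trace asks
for. -/
theorem mem_vanishingOn_of_tendsto {a : ℝ} {u : H1} {f : ℕ → Smooth}
    (hf : ∀ n y, (f n).1 (a, y) = 0) (hu : Tendsto (fun n => toH1 (f n)) atTop (𝓝 u)) :
    u ∈ vanishingOn a := by
  refine ⟨fun n => (f n).1, fun n => isSmooth (f n), ?_, fun i => ?_, ?_⟩
  · exact tendsto_toL2.1 ((continuous_fn.tendsto u).comp hu)
  · refine (tendsto_toL2 (f := fun n => D i (f n))).1 ?_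
    simpa only [Function.comp_def, partialD_toH1] using
      ((continuous_partialD i).tendsto u).comp hu
  · have : ∀ n, ((fun y => (f n).1 (a, y)) - 0 : UnitAddTorus (Fin 2) → ℝ) = 0 := fun n => by
      funext y; simp [hf]
    simp [this]

theorem norm_le_three_mul {a b c : ℝ} (hc : 0 ≤ c) (h : a ^ 2 + b ^ 2 ≤ 5 * c ^ 2) :
    a ≤ 3 * c ∧ b ≤ 3 * c :=
  ⟨abs_le_of_sq_le_sq' (by nlinarith [sq_nonneg b]) (by positivity) |>.2,
    abs_le_of_sq_le_sq' (by nlinarith [sq_nonneg a]) (by positivity) |>.2⟩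

/-- Every `v` has potentials that are limits of smooth ones: take smooth potentials of fields
converging to `v`; by the a priori estimate they form a Cauchy sequence. -/
theorem exists_isPotential (v : L2Field) : ∃ (η : H1Field) (φ : H1), IsPotential v η φ ∧
    ‖η‖ ≤ 3 * ‖v‖ ∧ ‖φ‖ ≤ 3 * ‖v‖ ∧
    ∃ g : ℕ → Smooth, (∀ n, g n ∈ parity 1) ∧ Tendsto (fun n => toH1 (g n)) atTop (𝓝 φ) := by
  have hv : v ∈ closure ((smoothPotentials.map potentialSum : Submodule ℝ L2Field) :
      Set L2Field) := by
    rw [← Submodule.topologicalClosure_coe, topologicalClosure_map_smoothPotentials]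
    trivial
  obtain ⟨r, hr, hrv⟩ := mem_closure_iff_seq_limit.1 hv
  choose p hp hpr using hr
  obtain rfl : r = fun n => potentialSum (p n) := funext fun n => (hpr n).symm
  have hbound : ∀ {q}, q ∈ smoothPotentials →
      ‖toH1Field q.1‖ ≤ 3 * ‖potentialSum q‖ ∧ ‖toH1 q.2‖ ≤ 3 * ‖potentialSum q‖ := fun hq =>
    norm_le_three_mul (norm_nonneg _) (norm_sq_add_norm_sq_le hq)
  have hcau := Metric.cauchySeq_iff.1 hrv.cauchySeq
  have hsub : ∀ m n, p m - p n ∈ smoothPotentials := fun m n => sub_mem (hp m) (hp n)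
  have hη : CauchySeq fun n => toH1Field (p n).1 := by
    refine Metric.cauchySeq_iff.2 fun δ hδ => ?_
    obtain ⟨N, hN⟩ := hcau (δ / 3) (by positivity)
    refine ⟨N, fun m hm n hn => ?_⟩
    have h1 := hN m hm n hn
    have h2 := (hbound (hsub m n)).1
    rw [dist_eq_norm, ← map_sub] at h1 ⊢
    exact h2.trans_lt (by linarith)
  have hφ : CauchySeq fun n => toH1 (p n).2 := by
    refine Metric.cauchySeq_iff.2 fun δ hδ => ?_
    obtain ⟨N, hN⟩ := hcau (δ / 3) (by positivity)
    refine ⟨N, fun m hm n hn => ?_⟩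
    have h1 := hN m hm n hn
    have h2 := (hbound (hsub m n)).2
    rw [dist_eq_norm, ← map_sub] at h1 ⊢
    exact h2.trans_lt (by linarith)
  obtain ⟨η, hη⟩ := cauchySeq_tendsto_of_complete hη
  obtain ⟨φ, hφ⟩ := cauchySeq_tendsto_of_complete hφ
  have hηi : ∀ i, Tendsto (fun n => toH1 ((p n).1 i)) atTop (𝓝 (η i)) := fun i =>
    ((continuous_coord i).tendsto η).comp hη
  have hpar := fun n => mem_fieldParity.1 (hp n).1.1
  refine ⟨η, φ, ⟨?_, ?_, ?_, ?_, ?_⟩, ?_, ?_, fun n => (p n).2, fun n => (hp n).2, hφ⟩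
  · exact mem_tangential.2
      ⟨mem_vanishingOn_of_tendsto (fun n => eq_zero_of_parity_neg_one (hpar n).2.1) (hηi 1),
        mem_vanishingOn_of_tendsto (fun n => eq_zero_of_parity_neg_one (hpar n).2.2) (hηi 2)⟩
  · exact mem_vanishingOn_of_tendsto (fun n => eq_zero_of_parity_one (hp n).2) hφ
  · refine tendsto_nhds_unique ((continuous_div.tendsto η).comp hη)
      (tendsto_const_nhds.congr fun n => ?_)
    rw [Function.comp_apply, div_toH1Field, LinearMap.mem_ker.1 (hp n).1.2, map_zero]
  · exact mem_vanishingOn_of_tendsto (fun n => eq_zero_of_parity_one (hpar n).1) (hηi 0)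
  · exact tendsto_nhds_unique hrv (((continuous_curl.tendsto η).comp hη).add
      ((continuous_grad.tendsto φ).comp hφ))
  · exact le_of_tendsto_of_tendsto' hη.norm (hrv.norm.const_mul 3) fun n => (hbound (hp n)).1
  · exact le_of_tendsto_of_tendsto' hφ.norm (hrv.norm.const_mul 3) fun n => (hbound (hp n)).2

/-! ### Orthogonality and uniqueness -/

/-- The gradient is determined by the function: test it against the smooth functions of a suitable
parity, which are dense. -/
theorem eq_zero_of_fn_eq_zero {ε : ℝ} (hε : ε = 1 ∨ ε = -1) {u : H1}
    (hu : u ∈ vanishingOn (-(1 + ε) / 2)) (h : fn u = 0) : u = 0 := by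
  have hgrad : grad u = 0 := by
    refine field_ext fun i => ?_
    rw [map_zero]
    change partialD i u = 0
    refine Fin.cases ?_ (fun j => ?_) i
    · refine eq_zero_of_inner_parity (one_or_neg_one_neg hε) fun g hg => ?_
      rw [inner_partialD_zero hε hu hg, h, inner_zero_left, neg_zero]
    · refine eq_zero_of_inner_parity hε fun g _ => ?_
      rw [inner_partialD_succ, h, inner_zero_left, neg_zero]
  rw [← norm_eq_zero, ← sq_eq_zero_iff, norm_sq_H1, h, hgrad]
  simp

/-- A function vanishing on `Γ₋` is zero if its gradient is orthogonal to the gradients of the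
smooth functions of the same parity. -/
theorem eq_zero_of_inner_grad {φ : H1} (hφ : φ ∈ vanishingOn (-1))
    (h : ∀ f ∈ parity 1, inner ℝ (grad φ) (grad (toH1 f)) = 0) : φ = 0 := by
  have hφ' : φ ∈ vanishingOn (-(1 + 1) / 2) := by norm_num; exact hφ
  refine eq_zero_of_fn_eq_zero (Or.inl rfl) hφ' ?_
  refine eq_zero_of_inner_lap (Or.inl rfl) fun f hf => ?_
  have := h f hf
  rwa [inner_grad_grad (Or.inl rfl) hφ' hf, neg_eq_zero] at this

/-- Functions vanishing on `Γ₋` are limits of smooth functions with the right parity: compare `φ`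
with the scalar potential of `∇φ`. -/
theorem exists_tendsto_toH1 {φ : H1} (hφ : φ ∈ vanishingOn (-1)) :
    ∃ g : ℕ → Smooth, (∀ n, g n ∈ parity 1) ∧ Tendsto (fun n => toH1 (g n)) atTop (𝓝 φ) := by
  obtain ⟨η, φ', hp, -, -, g, hg, hlim⟩ := exists_isPotential (grad φ)
  have h0 : φ - φ' = 0 := by
    refine eq_zero_of_inner_grad (sub_mem hφ hp.vanishing) fun f hf => ?_
    rw [map_sub, hp.eq, add_sub_cancel_right, inner_curl_grad_toH1 hp.tangential hf]
  exact ⟨g, hg, sub_eq_zero.1 h0 ▸ hlim⟩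

theorem inner_curl_grad {η : H1Field} (hη : η ∈ H1TangentialOnGamma) {φ : H1}
    (hφ : φ ∈ vanishingOn (-1)) : inner ℝ (curl η) (grad φ) = 0 := by
  obtain ⟨g, hg, hlim⟩ := exists_tendsto_toH1 hφ
  refine tendsto_nhds_unique
    (tendsto_const_nhds.inner ((continuous_grad.tendsto φ).comp hlim)) ?_
  exact tendsto_const_nhds.congr fun n => (inner_curl_grad_toH1 hη (hg n)).symm

theorem IsPotential.sub {v w : L2Field} {η ζ : H1Field} {φ ψ : H1} (h : IsPotential v η φ)
    (h' : IsPotential w ζ ψ) : IsPotential (v - w) (η - ζ) (φ - ψ) where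
  tangential := sub_mem h.tangential h'.tangential
  vanishing := sub_mem h.vanishing h'.vanishing
  div_eq_zero := by rw [map_sub, h.div_eq_zero, h'.div_eq_zero, sub_zero]
  normal_eq_zero := by rw [map_sub]; exact sub_mem h.normal_eq_zero h'.normal_eq_zero
  eq := by rw [h.eq, h'.eq, map_sub, map_sub]; abel

/-- By orthogonality `∇ × η` and `∇φ` vanish separately; then `φ` and all components of `η` are
orthogonal to the Laplacians of all smooth functions with the corresponding parity. -/
theorem IsPotential.eq_zero {η : H1Field} {φ : H1} (h : IsPotential 0 η φ) : η = 0 ∧ φ = 0 := by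
  have horth := inner_curl_grad h.tangential h.vanishing
  have hcurl : curl η = -grad φ := eq_neg_of_add_eq_zero_left h.eq.symm
  have hgrad : grad φ = 0 := by
    rwa [hcurl, inner_neg_left, neg_eq_zero, inner_self_eq_zero] at horth
  rw [hgrad, neg_zero] at hcurl
  refine ⟨PiLp.ext fun i => ?_, eq_zero_of_inner_grad h.vanishing fun f _ => by simp [hgrad]⟩
  refine eq_zero_of_fn_eq_zero (fieldSign_eq i)
    (mem_vanishingOn_fieldSign h.tangential h.normal_eq_zero i) ?_
  refine eq_zero_of_inner_lap (fieldSign_eq i) fun f hf => ?_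
  have hw := inner_curl_add_inner_div h.tangential h.normal_eq_zero
    (single_mem_fieldParity (δ := 1) (i := i) (f := f) (by simpa using hf))
  rw [hcurl, h.div_eq_zero, inner_zero_left, inner_zero_left, Finset.sum_eq_single i] at hw
  · simpa using hw
  · intro j _ hj
    simp [hj]
  · simp

theorem norm_grad_le (φ : H1) : ‖grad φ‖ ≤ ‖φ‖ :=
  abs_le_of_sq_le_sq' (by nlinarith [norm_sq_H1 φ, sq_nonneg ‖fn φ‖]) (norm_nonneg _) |>.2

end

end VacuumSlab

theorem proposition11 :
    (CurlTau ⟂ GradZero ∧ IsCompl CurlTau GradZero) ∧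
    ∃ C : ℝ, 0 < C ∧ ∀ v : L2Field,
      (∃! p : H1Field × H1, IsPotential v p.1 p.2) ∧
      ∀ (η : H1Field) (φ : H1), IsPotential v η φ → ‖η‖ + ‖grad φ‖ ≤ C * ‖v‖ := by
  have horth : CurlTau ⟂ GradZero := by
    rw [Submodule.isOrtho_iff_inner_eq]
    rintro _ ⟨η, hη, rfl⟩ _ ⟨φ, hφ, rfl⟩
    exact inner_curl_grad hη hφ
  have huniq : ∀ {v : L2Field} {η ζ : H1Field} {φ ψ : H1}, IsPotential v η φ →
      IsPotential v ζ ψ → η = ζ ∧ φ = ψ := by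
    intro v η ζ φ ψ h h'
    have h0 := h.sub h'
    rw [sub_self] at h0
    exact ⟨sub_eq_zero.1 h0.eq_zero.1, sub_eq_zero.1 h0.eq_zero.2⟩
  refine ⟨⟨horth, horth.disjoint, codisjoint_iff.2 (eq_top_iff.2 fun v _ => ?_)⟩,
    6, by norm_num, fun v => ?_⟩
  · obtain ⟨η, φ, h, -⟩ := exists_isPotential v
    rw [h.eq]
    exact Submodule.add_mem_sup ⟨η, h.tangential, rfl⟩ ⟨φ, h.vanishing, rfl⟩
  · obtain ⟨η, φ, h, hη, hφ, -⟩ := exists_isPotential v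
    refine ⟨⟨(η, φ), h, fun q hq => Prod.ext (huniq hq h).1 (huniq hq h).2⟩, fun ζ ψ h' => ?_⟩
    obtain ⟨rfl, rfl⟩ := huniq h' h
    linarith [norm_grad_le ψ]
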